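/- Identify the plane with $\mathbb{C}=\mathbb{R}^2$ and let $\sigma\subset\mathbb{C}$ be nonempty and compact. For a finite list $S=[x_0,\dots,x_n]$ ($n\ge 1$) of points of $\sigma$ with $x_{i}\ne x_{i+1}$ for all $i$, and a line $\ell$ in the plane, the segment from $x_i$ to $x_{i+1}$ is a crossing segment of $S$ on $\ell$ if $x_i$ and $x_{i+1}$ lie strictly on opposite sides of $\ell$, or $i=0$ and $x_0\in\ell$, or $x_i\notin\ell$ and $x_{i+1}\in\ell$. Let $\mathrm{vf}(S)$ be the maximum over all lines $\ell$ of the number of crossing segments of $S$ on $\ell$. For $f:\sigma\to\mathbb{C}$ put $$\mathrm{var}(f,\sigma)=\sup_S \frac{\sum_{i=1}^n|f(x_i)-f(x_{i-1})|}{\mathrm{vf}(S)},\qquad \|f\|_{BV(\sigma)}=\|f\|_\infty+\mathrm{var}(f,\sigma)$$ (one-point lists contribute $0$ to the supremum). Let $BV(\sigma)$ be the algebra of all $f:\sigma\to\mathbb{C}$ with $\|f\|_{BV(\sigma)}<\infty$, and let $AC(\sigma)$ be the closure in $BV(\sigma)$ of the set of restrictions to $\sigma$ of complex polynomials in the two real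 variables $\operatorname{Re} z,\operatorname{Im} z$. Write $AC[0,1]$ for $AC(\sigma)$ with $\sigma=[0,1]\subset\mathbb{R}\subset\mathbb{C}$. An isomorphism of Banach algebras is a bijective algebra homomorphism over $\mathbb{C}$ that is continuous with continuous inverse; $\simeq$ denotes its existence. A differentiable convex curve with endpoints $x\neq y$ is a set $c=\gamma([0,L])$, $L>0$, where $\gamma:[0,L]\to\mathbb{C}$ is continuous and one-to-one with $\gamma(0)=x$, $\gamma(L)=y$, is differentiable on $(0,L)$ with $|\gamma'|=1$ there, and where through each point of $c$ there is a line having $c$ in one of its closed half-planes. It is projectable if the image of $c$ under the orthogonal projection $P$ onto the line through $x$ and $y$ is exactly the segment $[x,y]$. **Theorem.** 1. If $c$ is a projectable (differentiable) convex curve, then $AC(c)\simeq AC[0,1]$. 2. Let $c$ be a projectable convex curve with endpoints $x,y$ which contains no line segment of positive length orthogonal to $y-x$. Then composition with the projection onto the chord is such an isomorphism: for $z \in c$ write $P(z)=x+s(z)(y-x)$ with $s(z)\in[0,1]$; then $g\mapsto g\circ s$ is a Banach algebra isomorphism of $AC[0,1]$ onto $AC(c)$. 3. Let $k:[0,1]\to\mathbb{R}$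 be a convex function that is continuous on $[0,1]$ and differentiable on $(0,1)$, and let $c=\{(t,k(t)) : 0\le t\le 1\}$. For $g:[0,1]\to\mathbb{C}$ define $\Psi(g):c\to\mathbb{C}$ by $\Psi(g)(t,k(t))=g(t)$. Then, for every $g:[0,1]\to\mathbb{C}$, $g\in AC[0,1]$ if and only if $\Psi(g)\in AC(c)$; and $\Psi$ is a Banach algebra isomorphism of $AC[0,1]$ onto $AC(c)$. -/

import Mathlib

open scoped ENNReal

noncomputable section

namespace PlaneAC

/-! ### Two-dimensional variation

The plane is `ℂ`, identified with `ℝ²` by real and imaginary parts. -/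

/-- The signed height of `z` over the line `{w | n.re * w.re + n.im * w.im = r}`
with normal vector `n` (a line when `n ≠ 0`). -/
def height (n : ℂ) (r : ℝ) (z : ℂ) : ℝ := n.re * z.re + n.im * z.im - r

/-- The segment from `x i` to `x (i + 1)` is a crossing segment of the list `x 0, x 1, …`
on the line with normal `n` and offset `r`. -/
def IsCrossing (n : ℂ) (r : ℝ) (x : ℕ → ℂ) (i : ℕ) : Prop :=
  height n r (x i) * height n r (x (i + 1)) < 0 ∨
  (i = 0 ∧ height n r (x i) = 0) ∨
  (height n r (x i) ≠ 0 ∧ height n r (x (i + 1)) = 0)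

open Classical in
/-- The number of crossing segments of the list `x 0, …, x m` on the given line. -/
def vfLine (n : ℂ) (r : ℝ) (x : ℕ → ℂ) (m : ℕ) : ℕ :=
  {i ∈ Finset.range m | IsCrossing n r x i}.card

/-- The variation factor of the list `x 0, …, x m`: the maximum, over all lines, of the number of
crossing segments. (For `m = 0` it is never used: the curve variation of a one-point list is `0`.)
-/
def vf (x : ℕ → ℂ) (m : ℕ) : ℕ :=
  ⨆ l : {n : ℂ // n ≠ 0} × ℝ, vfLine l.1 l.2 x m

/-- The numbers of crossing segments are bounded by the number of segments, so that the supremum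
in `vf` is a maximum. -/
theorem bddAbove_vfLine (x : ℕ → ℂ) (m : ℕ) :
    BddAbove (Set.range fun l : {n : ℂ // n ≠ 0} × ℝ => vfLine l.1 l.2 x m) := by
  refine ⟨m, ?_⟩
  rintro _ ⟨l, rfl⟩
  classical
  unfold vfLine
  exact (Finset.card_le_card (Finset.filter_subset _ _)).trans (by simp)

/-- The curve variation of `f` on the list `x 0, …, x m` of points of `σ`. -/
def cvar {σ : Set ℂ} (f : σ → ℂ) (x : ℕ → σ) (m : ℕ) : ℝ≥0∞ :=
  ∑ i ∈ Finset.range m, edist (f (x (i + 1))) (f (x i))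

/-- The two-dimensional variation of `f : σ → ℂ`: the supremum of `cvar / vf` over all finite
lists `x 0, …, x m` of points of `σ` in which consecutive points are different. -/
def var {σ : Set ℂ} (f : σ → ℂ) : ℝ≥0∞ :=
  ⨆ (m : ℕ) (x : ℕ → σ) (_ : ∀ i < m, x i ≠ x (i + 1)),
    cvar f x m / (vf (fun i => (x i : ℂ)) m : ℝ≥0∞)

/-- The variation norm `‖f‖_∞ + var(f, σ)`, with values in `[0, ∞]`. -/
def bvENorm {σ : Set ℂ} (f : σ → ℂ) : ℝ≥0∞ := (⨆ z, ‖f z‖ₑ) + var f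

/-! ### The variation norm is an algebra norm -/

section norm_facts

variable {σ : Set ℂ}

theorem var_le_of_cvar_le {h : σ → ℂ} {A : ℝ≥0∞}
    (H : ∀ (m : ℕ) (x : ℕ → σ), (∀ i < m, x i ≠ x (i + 1)) →
      cvar h x m / (vf (fun i => (x i : ℂ)) m : ℝ≥0∞) ≤ A) : var h ≤ A :=
  iSup_le fun m => iSup_le fun x => iSup_le fun hx => H m x hx

theorem le_var (f : σ → ℂ) {m : ℕ} {x : ℕ → σ} (hx : ∀ i < m, x i ≠ x (i + 1)) :
    cvar f x m / (vf (fun i => (x i : ℂ)) m : ℝ≥0∞) ≤ var f :=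
  le_iSup_of_le m (le_iSup_of_le x (le_iSup_of_le hx le_rfl))

theorem enorm_le_sup (f : σ → ℂ) (z : σ) : ‖f z‖ₑ ≤ ⨆ z, ‖f z‖ₑ :=
  le_iSup (fun z => ‖f z‖ₑ) z

theorem sup_le_bvENorm (f : σ → ℂ) : (⨆ z, ‖f z‖ₑ) ≤ bvENorm f := le_self_add

theorem var_add_le (f g : σ → ℂ) : var (f + g) ≤ var f + var g := by
  refine var_le_of_cvar_le fun m x hx => ?_
  refine le_trans ?_ (add_le_add (le_var f hx) (le_var g hx))
  rw [← ENNReal.add_div]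
  gcongr
  unfold cvar
  rw [← Finset.sum_add_distrib]
  exact Finset.sum_le_sum fun i _ => edist_add_add_le _ _ _ _

theorem var_mul_le (f g : σ → ℂ) :
    var (f * g) ≤ (⨆ z, ‖f z‖ₑ) * var g + (⨆ z, ‖g z‖ₑ) * var f := by
  refine var_le_of_cvar_le fun m x hx => ?_
  refine le_trans ?_ (add_le_add (mul_le_mul_right (le_var g hx) (⨆ z, ‖f z‖ₑ))
    (mul_le_mul_right (le_var f hx) (⨆ z, ‖g z‖ₑ)))
  rw [← mul_div_assoc, ← mul_div_assoc, ← ENNReal.add_div]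
  gcongr
  unfold cvar
  rw [Finset.mul_sum, Finset.mul_sum, ← Finset.sum_add_distrib]
  refine Finset.sum_le_sum fun i _ => ?_
  rw [edist_eq_enorm_sub, edist_eq_enorm_sub, edist_eq_enorm_sub]
  have h : (f * g) (x (i + 1)) - (f * g) (x i) =
      f (x (i + 1)) * (g (x (i + 1)) - g (x i)) + g (x i) * (f (x (i + 1)) - f (x i)) := by
    simp only [Pi.mul_apply]; ring
  rw [h]
  refine (enorm_add_le _ _).trans ?_
  rw [enorm_mul, enorm_mul]
  gcongr
  · exact enorm_le_sup f _
  · exact enorm_le_sup g _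

theorem var_const (a : ℂ) : var (fun _ : σ => a) = 0 := by
  refine le_antisymm (var_le_of_cvar_le fun m x _ => ?_) bot_le
  simp [cvar]

theorem bvENorm_add_le (f g : σ → ℂ) : bvENorm (f + g) ≤ bvENorm f + bvENorm g := by
  have h : (⨆ z, ‖(f + g) z‖ₑ) ≤ (⨆ z, ‖f z‖ₑ) + ⨆ z, ‖g z‖ₑ :=
    iSup_le fun z => (enorm_add_le _ _).trans (add_le_add (enorm_le_sup f z) (enorm_le_sup g z))
  calc bvENorm (f + g) ≤ ((⨆ z, ‖f z‖ₑ) + ⨆ z, ‖g z‖ₑ) + (var f + var g) :=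
        add_le_add h (var_add_le f g)
    _ = bvENorm f + bvENorm g := by unfold bvENorm; ring

theorem bvENorm_mul_le (f g : σ → ℂ) : bvENorm (f * g) ≤ bvENorm f * bvENorm g := by
  have h : (⨆ z, ‖(f * g) z‖ₑ) ≤ (⨆ z, ‖f z‖ₑ) * ⨆ z, ‖g z‖ₑ :=
    iSup_le fun z => by
      rw [Pi.mul_apply, enorm_mul]
      exact mul_le_mul' (enorm_le_sup f z) (enorm_le_sup g z)
  calc bvENorm (f * g)
      ≤ ((⨆ z, ‖f z‖ₑ) * ⨆ z, ‖g z‖ₑ) +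
          ((⨆ z, ‖f z‖ₑ) * var g + (⨆ z, ‖g z‖ₑ) * var f) := add_le_add h (var_mul_le f g)
    _ ≤ ((⨆ z, ‖f z‖ₑ) * ⨆ z, ‖g z‖ₑ) +
          ((⨆ z, ‖f z‖ₑ) * var g + (⨆ z, ‖g z‖ₑ) * var f) + var f * var g := le_self_add
    _ = bvENorm f * bvENorm g := by unfold bvENorm; ring

theorem bvENorm_const_le (a : ℂ) : bvENorm (fun _ : σ => a) ≤ ‖a‖ₑ := by
  unfold bvENorm
  rw [var_const, add_zero]
  exact iSup_le fun _ => le_rfl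

theorem bvENorm_neg (f : σ → ℂ) : bvENorm (-f) = bvENorm f := by
  simp [bvENorm, var, cvar, edist_neg_neg]

theorem bvENorm_zero : bvENorm (0 : σ → ℂ) = 0 :=
  le_antisymm ((bvENorm_const_le (σ := σ) 0).trans (by simp)) bot_le

theorem eq_zero_of_bvENorm_eq_zero {f : σ → ℂ} (h : bvENorm f = 0) : f = 0 := by
  funext z
  have h1 : ‖f z‖ₑ ≤ 0 := h ▸ (enorm_le_sup f z).trans (sup_le_bvENorm f)
  simpa using h1

end norm_facts

/-! ### The Banach algebras `BV(σ)` and `AC(σ)` -/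

/-- The functions of bounded variation on `σ`, as a subalgebra of the algebra of all functions. -/
def bvSubalgebra (σ : Set ℂ) : Subalgebra ℂ (σ → ℂ) where
  carrier := {f | bvENorm f < ∞}
  mul_mem' {f g} hf hg := (bvENorm_mul_le f g).trans_lt (ENNReal.mul_lt_top hf hg)
  add_mem' {f g} hf hg := (bvENorm_add_le f g).trans_lt (ENNReal.add_lt_top.2 ⟨hf, hg⟩)
  algebraMap_mem' a := (bvENorm_const_le a).trans_lt enorm_lt_top

/-- The algebra `BV(σ)`. It is a type of its own so that it carries the variation norm, and not
the topology of pointwise convergence. -/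
def BV (σ : Set ℂ) : Type := bvSubalgebra σ

instance instCommRingBV (σ : Set ℂ) : CommRing (BV σ) :=
  inferInstanceAs (CommRing (bvSubalgebra σ))

instance instAlgebraBV (σ : Set ℂ) : Algebra ℂ (BV σ) :=
  inferInstanceAs (Algebra ℂ (bvSubalgebra σ))

/-- The inclusion of `BV(σ)` into the algebra of all functions `σ → ℂ`. -/
def BV.toFun (σ : Set ℂ) : BV σ →ₐ[ℂ] (σ → ℂ) := (bvSubalgebra σ).val

theorem BV.toFun_injective (σ : Set ℂ) : Function.Injective (BV.toFun σ) :=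
  Subtype.val_injective

theorem BV.bvENorm_lt_top {σ : Set ℂ} (f : BV σ) : bvENorm (BV.toFun σ f) < ∞ := f.2

/-- The variation norm on `BV(σ)`. -/
def bvRingNorm (σ : Set ℂ) : RingNorm (BV σ) where
  toFun f := (bvENorm (BV.toFun σ f)).toReal
  map_zero' := by rw [map_zero, bvENorm_zero, ENNReal.toReal_zero]
  add_le' f g := by
    rw [map_add, ← ENNReal.toReal_add f.bvENorm_lt_top.ne g.bvENorm_lt_top.ne]
    exact ENNReal.toReal_mono
      (ENNReal.add_lt_top.2 ⟨f.bvENorm_lt_top, g.bvENorm_lt_top⟩).ne (bvENorm_add_le _ _)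
  neg' f := by rw [map_neg, bvENorm_neg]
  mul_le' f g := by
    rw [map_mul, ← ENNReal.toReal_mul]
    exact ENNReal.toReal_mono
      (ENNReal.mul_lt_top f.bvENorm_lt_top g.bvENorm_lt_top).ne (bvENorm_mul_le _ _)
  eq_zero_of_map_eq_zero' f hf := by
    refine BV.toFun_injective σ ?_
    rw [map_zero]
    exact eq_zero_of_bvENorm_eq_zero
      (((ENNReal.toReal_eq_zero_iff _).1 hf).resolve_right f.bvENorm_lt_top.ne)

instance instNormedCommRingBV (σ : Set ℂ) : NormedCommRing (BV σ) :=
  { RingNorm.toNormedRing (bvRingNorm σ), instCommRingBV σ with }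

theorem BV.norm_def {σ : Set ℂ} (f : BV σ) : ‖f‖ = (bvENorm (BV.toFun σ f)).toReal := rfl

instance instNormedAlgebraBV (σ : Set ℂ) : NormedAlgebra ℂ (BV σ) :=
  { instAlgebraBV σ with
    norm_smul_le := fun a f => by
      rw [BV.norm_def, BV.norm_def, map_smul]
      have h : a • BV.toFun σ f = (fun _ => a) * BV.toFun σ f := rfl
      rw [h, ← toReal_enorm a, ← ENNReal.toReal_mul]
      refine ENNReal.toReal_mono (ENNReal.mul_lt_top enorm_lt_top f.bvENorm_lt_top).ne ?_
      exact (bvENorm_mul_le _ _).trans (mul_le_mul' (bvENorm_const_le a) le_rfl) }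

/-- The restrictions to `σ` of the complex polynomials `p(x, y)` in two real variables. -/
def polyFun (σ : Set ℂ) : Subalgebra ℂ (σ → ℂ) :=
  (MvPolynomial.aeval
    (![fun z => ((z : ℂ).re : ℂ), fun z => ((z : ℂ).im : ℂ)] : Fin 2 → σ → ℂ)).range

/-- The algebra `AC(σ)` of absolutely continuous functions on `σ`: the closure in `BV(σ)` of the
polynomial functions (for compact `σ`, these all belong to `BV(σ)`). -/
def AC (σ : Set ℂ) : Subalgebra ℂ (BV σ) :=
  ((polyFun σ).comap (BV.toFun σ)).topologicalClosure

/-- The function `σ → ℂ` underlying an element of `AC(σ)`. -/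
def acFun {σ : Set ℂ} (f : AC σ) : σ → ℂ := BV.toFun σ (f : BV σ)

/-- A function `f : σ → ℂ` belongs to `AC(σ)`. -/
def IsAC {σ : Set ℂ} (f : σ → ℂ) : Prop := ∃ F : AC σ, acFun F = f

/-- The interval `[0, 1]` of the real axis, as a subset of the plane. -/
def unitSeg : Set ℂ := (fun t : ℝ => (t : ℂ)) '' Set.Icc 0 1

/-! ### Projectable convex curves -/

/-- `c` is a differentiable convex curve with (distinct) endpoints `x` and `y`: the image of a
one-to-one arc-length parametrization which is differentiable except perhaps at its ends, with a
supporting line through every point. -/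
def IsConvexCurve (c : Set ℂ) (x y : ℂ) : Prop :=
  (∃ (L : ℝ) (γ : ℝ → ℂ), 0 < L ∧ ContinuousOn γ (Set.Icc 0 L) ∧ Set.InjOn γ (Set.Icc 0 L) ∧
    (∀ t ∈ Set.Ioo 0 L, DifferentiableAt ℝ γ t ∧ ‖deriv γ t‖ = 1) ∧
    γ '' Set.Icc 0 L = c ∧ γ 0 = x ∧ γ L = y) ∧
  ∀ z ∈ c, ∃ (n : ℂ) (r : ℝ), n ≠ 0 ∧ height n r z = 0 ∧ ∀ w ∈ c, 0 ≤ height n r w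

/-- The orthogonal projection of the plane onto the line through `x` and `y`. -/
def chordProj (x y z : ℂ) : ℂ :=
  EuclideanGeometry.orthogonalProjection line[ℝ, x, y] z

/-- `c` is a projectable convex curve with endpoints `x` and `y`. -/
def IsProjectable (c : Set ℂ) (x y : ℂ) : Prop :=
  IsConvexCurve c x y ∧ chordProj x y '' c = segment ℝ x y

/-- No line segment of positive length that is contained in `c` is orthogonal to the line through
`x` and `y`. -/
def NoOrthogonalSegment (c : Set ℂ) (x y : ℂ) : Prop :=
  ∀ z w : ℂ, z ≠ w → segment ℝ z w ⊆ c → inner ℝ (w - z) (y - x) ≠ 0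

/-! ### Graphs of convex functions -/

/-- The graph over `[0, 1]` of the function `k`. -/
def graphSet (k : ℝ → ℝ) : Set ℂ := (fun t : ℝ => (⟨t, k t⟩ : ℂ)) '' Set.Icc 0 1

theorem re_mem_unitSeg {k : ℝ → ℝ} (p : graphSet k) : (((p : ℂ).re : ℝ) : ℂ) ∈ unitSeg := by
  obtain ⟨_, t, ht, rfl⟩ := p
  exact ⟨t, ht, rfl⟩

/-- The function `(t, k(t)) ↦ g(t)` on the graph of `k`. -/
def graphLift (k : ℝ → ℝ) (g : unitSeg → ℂ) : graphSet k → ℂ :=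
  fun p => g ⟨(((p : ℂ).re : ℝ) : ℂ), re_mem_unitSeg p⟩

end PlaneAC

end

/-!
An injective map between plane sets induces a homomorphism of the algebras of absolutely
continuous functions, by composition, as soon as its two coordinate functions are absolutely
continuous and it multiplies variation factors by at most a constant (`IsACMap`). A bijection that
is such a map in both directions induces an isomorphism (`IsACEquiv.acEquiv`). Three kinds of
bijections are used.

* Affine and projective maps: they carry lines to lines and preserve the sides of lines, so they
  do not change variation factors at all.
* The projection of the graph of a continuous convex function `k` onto `[0, 1]`. A line meets the
  graph in at most two points or in a segment, so the graph has at most three times the variation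
  factor of its projection (`vf_graphSet_le`). It remains to see that `k` itself belongs to `AC[0,
  1]`. Its right derivative is integrable; a polynomial close to it in `L¹` has a primitive close
  to `k` in the variation norm, because counting crossings of the lines orthogonal to one
  direction and integrating over these lines bounds the variation of a function of one coordinate
  by the `L¹` norm of its derivative (`var_le_measure_univ`, `isAC_comp_height_of_convexOn`). The
  same fact makes the denominators of projective maps invertible in `AC(σ)`.

This settles graphs of convex functions. A projectable curve is first normalized to have the chord
`[0, 1]`. The supporting lines keep it on one side of the chord, and make it the graph of a convex
or concave function as soon as it meets the two lines orthogonal to the chord at its ends only in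
these ends (`IsSupportedArc.exists_eq_graphSet`). That is the case if it contains no segment
orthogonal to the chord (`IsSupportedArc.eq_ends_of_no_vertical_segment`), and it can always be
achieved by a projective map that fixes the chord and tilts the two lines inwards
(`IsSupportedArc.perspective_image`).
-/

noncomputable section

namespace PlaneAC

open Set MeasureTheory

section

/-! ### Crossing segments and the variation factor -/

theorem zero_mem_crossing {n : ℂ} {r : ℝ} {x : ℕ → ℂ} (h : height n r (x 0) = 0) :
    IsCrossing n r x 0 := Or.inr (Or.inl ⟨rfl, h⟩)

theorem one_le_vf (x : ℕ → ℂ) {m : ℕ} (hm : 0 < m) : 1 ≤ vf x m := by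
  classical
  refine le_trans ?_ (le_ciSup (bddAbove_vfLine x m) ⟨⟨1, one_ne_zero⟩, (x 0).re⟩)
  refine Finset.card_pos.2 ⟨0, ?_⟩
  simp only [Finset.mem_filter, Finset.mem_range]
  exact ⟨hm, zero_mem_crossing (by simp [height])⟩

/-- The bound holds for the degenerate normal `n = 0` as well: then all heights are equal, and at
most the initial segment is crossing. -/
theorem vfLine_le_vf (n : ℂ) (r : ℝ) (x : ℕ → ℂ) (m : ℕ) : vfLine n r x m ≤ vf x m := by
  classical
  rcases eq_or_ne n 0 with rfl | hn
  · rcases Nat.eq_zero_or_pos m with rfl | hm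
    · simp [vfLine]
    · refine le_trans ?_ (one_le_vf x hm)
      refine Finset.card_le_one.2 fun i hi j hj => ?_
      have key : ∀ i, IsCrossing 0 r x i → i = 0 := by
        rintro i (h | h | h)
        · simp only [height, Complex.zero_re, Complex.zero_im, zero_mul, add_zero] at h
          exact absurd h (not_lt.2 (mul_self_nonneg _))
        · exact h.1
        · exact absurd (by simpa [height] using h.2) h.1
      rw [key i (Finset.mem_filter.1 hi).2, key j (Finset.mem_filter.1 hj).2]
  · exact le_ciSup (bddAbove_vfLine x m) (⟨⟨n, hn⟩, r⟩ : {n : ℂ // n ≠ 0} × ℝ)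

theorem vf_le_of_vfLine_le {x : ℕ → ℂ} {m b : ℕ} (h : ∀ n r, n ≠ 0 → vfLine n r x m ≤ b) :
    vf x m ≤ b :=
  haveI : Nonempty ({n : ℂ // n ≠ 0} × ℝ) := ⟨⟨1, one_ne_zero⟩, 0⟩
  ciSup_le fun l => h l.1 l.2 l.1.2

theorem vfLine_le_of_imp {n n' : ℂ} {r r' : ℝ} {x x' : ℕ → ℂ} (m : ℕ)
    (h : ∀ i, IsCrossing n r x i → IsCrossing n' r' x' i) : vfLine n r x m ≤ vfLine n' r' x' m := by
  classical
  exact Finset.card_le_card (Finset.monotone_filter_right _ fun i _ => h i)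

/-- A map that pulls every line back to a line (or to the empty set or the whole domain, when the
normal `n'` below is `0`), sides included, does not increase the variation factor. -/
theorem vf_comp_le_of_height_eq {σ τ : Set ℂ} {φ : σ → τ}
    (h : ∀ (n : ℂ) (r : ℝ), ∃ (n' : ℂ) (r' : ℝ), ∀ z : σ, ∃ ρ : ℝ, 0 < ρ ∧
      height n r (φ z) = ρ * height n' r' z) (x : ℕ → σ) (m : ℕ) :
    vf (fun i => (φ (x i) : ℂ)) m ≤ vf (fun i => (x i : ℂ)) m := by
  refine vf_le_of_vfLine_le fun n r _ => ?_
  obtain ⟨n', r', H⟩ := h n r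
  refine le_trans (vfLine_le_of_imp m fun i hi => ?_) (vfLine_le_vf n' r' _ m)
  obtain ⟨ρ, hρ, e⟩ := H (x i)
  obtain ⟨ρ', hρ', e'⟩ := H (x (i + 1))
  simp only [IsCrossing] at hi ⊢
  rw [e, e'] at hi
  rcases hi with hi | ⟨h0, hi⟩ | ⟨h1, h2⟩
  · left
    have : ρ * height n' r' (x i) * (ρ' * height n' r' (x (i + 1))) =
      (ρ * ρ') * (height n' r' (x i) * height n' r' (x (i + 1))) := by ring
    rw [this] at hi
    by_contra hc
    exact absurd hi (not_lt.2 (mul_nonneg (mul_pos hρ hρ').le (not_lt.1 hc)))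
  · exact Or.inr (Or.inl ⟨h0, (mul_eq_zero.1 hi).resolve_left hρ.ne'⟩)
  · exact Or.inr (Or.inr ⟨(mul_ne_zero_iff.1 h1).2, (mul_eq_zero.1 h2).resolve_left hρ'.ne'⟩)

/-! ### Bounding the variation along one direction -/

/-- Integrate, over the offset `t` of the lines with normal `n`, the number of segments of a list
that strictly cross the line: that number never exceeds the variation factor. -/
theorem var_le_measure_univ {σ : Set ℂ} (n : ℂ) (f : σ → ℂ) (μ : Measure ℝ)
    (h : ∀ z w : σ, edist (f w) (f z) ≤ μ (uIoo (height n 0 z) (height n 0 w))) :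
    var f ≤ μ univ := by
  classical
  refine var_le_of_cvar_le fun m x _ => ENNReal.div_le_of_le_mul ?_
  have hmeas : ∀ i, MeasurableSet (uIoo (height n 0 (x i)) (height n 0 (x (i + 1)))) :=
    fun i => measurableSet_Ioo
  calc cvar f x m
      ≤ ∑ i ∈ Finset.range m, μ (uIoo (height n 0 (x i)) (height n 0 (x (i + 1)))) :=
        Finset.sum_le_sum fun i _ => h _ _
    _ = ∑ i ∈ Finset.range m,
          ∫⁻ t, (uIoo (height n 0 (x i)) (height n 0 (x (i + 1)))).indicator 1 t ∂μ :=
        Finset.sum_congr rfl fun i _ => (lintegral_indicator_one (hmeas i)).symm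
    _ = ∫⁻ t, ∑ i ∈ Finset.range m,
          (uIoo (height n 0 (x i)) (height n 0 (x (i + 1)))).indicator 1 t ∂μ :=
        (lintegral_finsetSum _ fun i _ => measurable_one.indicator (hmeas i)).symm
    _ ≤ ∫⁻ _, (vf (fun i => (x i : ℂ)) m : ℝ≥0∞) ∂μ := by
        refine lintegral_mono fun t => ?_
        refine le_trans ?_ (Nat.cast_le.2 (vfLine_le_vf n t (fun i => (x i : ℂ)) m))
        simp only [indicator_apply, Pi.one_apply, Finset.sum_boole]
        refine Nat.cast_le.2 (Finset.card_le_card (Finset.monotone_filter_right _ fun i _ hi => ?_))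
        left
        simp only [uIoo, mem_Ioo, height, sub_zero, inf_lt_iff, lt_sup_iff] at hi ⊢
        obtain ⟨h1 | h1, h2 | h2⟩ := hi
        · linarith
        · nlinarith
        · nlinarith
        · linarith
    _ = μ univ * vf (fun i => (x i : ℂ)) m := by rw [lintegral_const, mul_comm]

/-! ### Membership in `AC(σ)` -/

variable {σ : Set ℂ}

theorem isAC_iff {f : σ → ℂ} : IsAC f ↔ ∃ F : BV σ, F ∈ AC σ ∧ BV.toFun σ F = f :=
  ⟨fun ⟨F, h⟩ => ⟨F, F.2, h⟩, fun ⟨F, hF, h⟩ => ⟨⟨F, hF⟩, h⟩⟩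

theorem acFun_injective : Function.Injective (acFun (σ := σ)) := fun _ _ h =>
  Subtype.ext (BV.toFun_injective σ h)

theorem IsAC.bvENorm_lt_top {f : σ → ℂ} (hf : IsAC f) : bvENorm f < ∞ := by
  obtain ⟨F, rfl⟩ := hf
  exact (F : BV σ).bvENorm_lt_top

theorem exists_toFun_eq {f : σ → ℂ} (hf : bvENorm f < ∞) : ∃ F : BV σ, BV.toFun σ F = f :=
  ⟨(⟨f, hf⟩ : bvSubalgebra σ), rfl⟩

/-- The functions in `AC(σ)` as a subalgebra of all functions. -/
def acSubalgebra (σ : Set ℂ) : Subalgebra ℂ (σ → ℂ) := (AC σ).map (BV.toFun σ)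

theorem mem_acSubalgebra {f : σ → ℂ} : f ∈ acSubalgebra σ ↔ IsAC f := by
  rw [isAC_iff]; rfl

theorem IsAC.add {f g : σ → ℂ} (hf : IsAC f) (hg : IsAC g) : IsAC (f + g) :=
  mem_acSubalgebra.1 (add_mem (mem_acSubalgebra.2 hf) (mem_acSubalgebra.2 hg))

theorem IsAC.sub {f g : σ → ℂ} (hf : IsAC f) (hg : IsAC g) : IsAC (f - g) :=
  mem_acSubalgebra.1 (sub_mem (mem_acSubalgebra.2 hf) (mem_acSubalgebra.2 hg))

theorem IsAC.mul {f g : σ → ℂ} (hf : IsAC f) (hg : IsAC g) : IsAC (f * g) :=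
  mem_acSubalgebra.1 (mul_mem (mem_acSubalgebra.2 hf) (mem_acSubalgebra.2 hg))

theorem isAC_const (a : ℂ) : IsAC (fun _ : σ => a) :=
  mem_acSubalgebra.1 ((acSubalgebra σ).algebraMap_mem a)

theorem IsAC.aeval {f : σ → ℂ} (hf : IsAC f) (p : Polynomial ℂ) : IsAC (Polynomial.aeval f p) :=
  mem_acSubalgebra.1 (by
    rw [← Polynomial.aeval_subalgebra_coe p (acSubalgebra σ) ⟨f, mem_acSubalgebra.2 hf⟩]
    exact Subtype.property _)

theorem isAC_of_mem_polyFun {f : σ → ℂ} (hf : f ∈ polyFun σ) (hbv : bvENorm f < ∞) : IsAC f := by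
  obtain ⟨F, rfl⟩ := exists_toFun_eq hbv
  exact isAC_iff.2 ⟨F, Subalgebra.le_topologicalClosure _ hf, rfl⟩

/-- `AC(σ)` is closed in the variation norm. -/
theorem isAC_of_forall_exists_bvENorm_sub_le {f : σ → ℂ}
    (h : ∀ ε : ℝ, 0 < ε → ∃ g : σ → ℂ, IsAC g ∧ bvENorm (f - g) ≤ ENNReal.ofReal ε) : IsAC f := by
  have hf : bvENorm f < ∞ := by
    obtain ⟨g, hg, hfg⟩ := h 1 one_pos
    have := bvENorm_add_le (f - g) g
    rw [sub_add_cancel] at this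
    exact this.trans_lt (ENNReal.add_lt_top.2 ⟨hfg.trans_lt ENNReal.ofReal_lt_top,
      hg.bvENorm_lt_top⟩)
  obtain ⟨F, rfl⟩ := exists_toFun_eq hf
  refine isAC_iff.2 ⟨F, ?_, rfl⟩
  have hc : IsClosed (AC σ : Set (BV σ)) := Subalgebra.isClosed_topologicalClosure _
  refine hc.closure_subset (Metric.mem_closure_iff.2 fun ε hε => ?_)
  obtain ⟨g, hg, hfg⟩ := h (ε / 2) (half_pos hε)
  obtain ⟨G, hG, rfl⟩ := isAC_iff.1 hg
  refine ⟨G, hG, ?_⟩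
  rw [dist_eq_norm, BV.norm_def, map_sub]
  refine lt_of_le_of_lt (ENNReal.toReal_mono ENNReal.ofReal_ne_top hfg) ?_
  rw [ENNReal.toReal_ofReal (half_pos hε).le]
  linarith

theorem edist_ofReal (a b : ℝ) : edist (a : ℂ) (b : ℂ) = ENNReal.ofReal |a - b| := by
  rw [edist_dist, Complex.dist_eq, ← Complex.ofReal_sub, Complex.norm_real, Real.norm_eq_abs]

theorem bvENorm_height_lt_top (hσ : Bornology.IsBounded σ) (n : ℂ) :
    bvENorm (fun z : σ => (height n 0 z : ℂ)) < ∞ := by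
  obtain ⟨M, hM⟩ := hσ.exists_norm_le
  have hb : ∀ z : σ, |height n 0 z| ≤ ‖n‖ * M + ‖n‖ * M := fun z => by
    have h1 := (Complex.abs_re_le_norm (z : ℂ)).trans (hM z z.2)
    have h2 := (Complex.abs_im_le_norm (z : ℂ)).trans (hM z z.2)
    have h3 := Complex.abs_re_le_norm n
    have h4 := Complex.abs_im_le_norm n
    unfold height
    rw [sub_zero]
    refine (abs_add_le _ _).trans ?_
    rw [abs_mul, abs_mul]
    gcongr
  set B := ‖n‖ * M + ‖n‖ * M
  refine ENNReal.add_lt_top.2 ⟨?_, ?_⟩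
  · refine lt_of_le_of_lt (iSup_le fun z => ?_) (ENNReal.ofReal_lt_top (r := B))
    rw [← ofReal_norm, Complex.norm_real]
    exact ENNReal.ofReal_le_ofReal (hb z)
  · refine lt_of_le_of_lt (var_le_measure_univ n _ (volume.restrict (Icc (-B) B)) fun z w => ?_) ?_
    · have hz := abs_le.1 (hb z)
      have hw := abs_le.1 (hb w)
      rw [uIoo, Measure.restrict_apply measurableSet_Ioo, inter_eq_left.2, edist_ofReal]
      · rw [Real.volume_Ioo, abs_sub_comm, ← max_sub_min_eq_abs']
      · intro t ht
        exact ⟨(le_inf hz.1 hw.1).trans ht.1.le, ht.2.le.trans (sup_le hz.2 hw.2)⟩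
    · simp

theorem isAC_re (hσ : Bornology.IsBounded σ) : IsAC (fun z : σ => ((z : ℂ).re : ℂ)) := by
  refine isAC_of_mem_polyFun ⟨MvPolynomial.X 0, ?_⟩ ?_
  · simp
  · simpa [height] using bvENorm_height_lt_top hσ 1

theorem isAC_im (hσ : Bornology.IsBounded σ) : IsAC (fun z : σ => ((z : ℂ).im : ℂ)) := by
  refine isAC_of_mem_polyFun ⟨MvPolynomial.X 1, ?_⟩ ?_
  · simp
  · simpa [height] using bvENorm_height_lt_top hσ Complex.I

theorem isAC_height (hσ : Bornology.IsBounded σ) (n : ℂ) (r : ℝ) :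
    IsAC (fun z : σ => (height n r z : ℂ)) := by
  have := (((isAC_const (n.re : ℂ)).mul (isAC_re hσ)).add
    ((isAC_const (n.im : ℂ)).mul (isAC_im hσ))).sub (isAC_const (r : ℂ))
  convert this using 1
  funext z
  simp [height]

end

/-! ### Absolutely continuous functions of one coordinate -/

/-- A continuous convex function on `[a, b]`, possibly with infinite slope at the ends, is the
integral of its right derivative. -/
theorem exists_integrableOn_integral_eq_sub {a b : ℝ} (hab : a < b) {k : ℝ → ℝ}
    (hk : ConvexOn ℝ (Icc a b) k) (hc : ContinuousOn k (Icc a b)) :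
    ∃ h : ℝ → ℝ, IntegrableOn h (Icc a b) ∧
      ∀ s ∈ Icc a b, ∀ t ∈ Icc a b, s ≤ t → ∫ u in s..t, h u = k t - k s := by
  set h : ℝ → ℝ := fun u => derivWithin k (Ioi u) u with hh
  have hd : ∀ u ∈ Ioo a b, HasDerivWithinAt k (h u) (Ioi u) u := fun u hu =>
    hk.hasDerivWithinAt_rightDeriv_of_mem_interior (by rwa [interior_Icc])
  have hm : MonotoneOn h (Ioo a b) := by
    have := hk.monotoneOn_rightDeriv
    rwa [interior_Icc] at this
  obtain ⟨c, hac, hcb⟩ := exists_between hab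
  -- On either side of `c`, subtracting the slope at `c` gives the right derivative a fixed sign.
  have h1 : IntegrableOn h (Ioc c b) := by
    have : IntegrableOn (fun u => h u - h c) (Ioc c b) := by
      refine intervalIntegral.integrableOn_deriv_right_of_nonneg (g := fun u => k u - h c * u)
        ?_ (fun u hu => ?_) fun u hu => ?_
      · exact (hc.mono (Icc_subset_Icc_left hac.le)).sub (by fun_prop)
      · have := (hd u ⟨hac.trans hu.1, hu.2⟩)
          |>.sub ((hasDerivAt_id u).const_mul (h c)).hasDerivWithinAt
        rwa [mul_one] at this
      · exact sub_nonneg.2 (hm ⟨hac, hcb⟩ ⟨hac.trans hu.1, hu.2⟩ hu.1.le)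
    have h2 := this.add (integrableOn_const (C := h c) (by simp))
    refine h2.congr_fun (fun u _ => ?_) measurableSet_Ioc
    simp
  have h2 : IntegrableOn h (Ioc a c) := by
    have : IntegrableOn (fun u => h c - h u) (Ioc a c) := by
      refine intervalIntegral.integrableOn_deriv_right_of_nonneg (g := fun u => h c * u - k u)
        ?_ (fun u hu => ?_) fun u hu => ?_
      · exact ContinuousOn.sub (by fun_prop) (hc.mono (Icc_subset_Icc_right hcb.le))
      · have := ((hasDerivAt_id u).const_mul (h c)).hasDerivWithinAt.sub
          (hd u ⟨hu.1, hu.2.trans hcb⟩)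
        rwa [mul_one] at this
      · exact sub_nonneg.2 (hm ⟨hu.1, hu.2.trans hcb⟩ ⟨hac, hcb⟩ hu.2.le)
    have h2 := (integrableOn_const (μ := volume) (s := Ioc a c) (C := h c) (by simp)).sub this
    refine h2.congr_fun (fun u _ => ?_) measurableSet_Ioc
    simp
  have h3 : IntegrableOn h (Icc a b) := by
    rw [integrableOn_Icc_iff_integrableOn_Ioc, ← Ioc_union_Ioc_eq_Ioc hac.le hcb.le]
    exact h2.union h1
  refine ⟨h, h3, fun s hs t ht hst => ?_⟩
  refine intervalIntegral.integral_eq_sub_of_hasDeriv_right_of_le hst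
    (hc.mono (Icc_subset_Icc hs.1 ht.2))
    (fun u hu => hd u ⟨hs.1.trans_lt hu.1, hu.2.trans_le ht.2⟩) ?_
  rw [intervalIntegrable_iff_integrableOn_Ioc_of_le hst]
  exact h3.mono_set (Ioc_subset_Icc_self.trans (Icc_subset_Icc hs.1 ht.2))

theorem exists_derivative_eq (p : Polynomial ℝ) : ∃ P : Polynomial ℝ, P.derivative = p := by
  induction p using Polynomial.induction_on' with
  | add p q hp hq =>
    obtain ⟨P, rfl⟩ := hp
    obtain ⟨Q, rfl⟩ := hq
    exact ⟨P + Q, Polynomial.derivative_add⟩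
  | monomial n c =>
    refine ⟨Polynomial.monomial (n + 1) (c / (n + 1)), ?_⟩
    rw [Polynomial.derivative_monomial, Nat.add_sub_cancel, Nat.cast_add, Nat.cast_one,
      div_mul_cancel₀ _ (by positivity)]

theorem exists_polynomial_lintegral_sub_le {a b : ℝ} (hab : a < b) {h : ℝ → ℝ}
    (hh : IntegrableOn h (Icc a b)) {ε : ℝ} (hε : 0 < ε) :
    ∃ p : Polynomial ℝ, ∫⁻ u in Icc a b, ‖h u - p.eval u‖ₑ ≤ ENNReal.ofReal ε := by
  obtain ⟨g, hg, -⟩ := Integrable.exists_boundedContinuous_lintegral_sub_le hh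
    (ENNReal.ofReal_pos.2 (half_pos hε)).ne'
  have hδ : 0 < ε / 2 / (b - a) := div_pos (half_pos hε) (sub_pos.2 hab)
  obtain ⟨p, hp⟩ := exists_polynomial_near_of_continuousOn a b g g.continuous.continuousOn _ hδ
  refine ⟨p, ?_⟩
  calc ∫⁻ u in Icc a b, ‖h u - p.eval u‖ₑ
      ≤ ∫⁻ u in Icc a b, (‖h u - g u‖ₑ + ENNReal.ofReal (ε / 2 / (b - a))) := by
        refine setLIntegral_mono' measurableSet_Icc fun u hu => ?_
        rw [← sub_add_sub_cancel (h u) (g u)]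
        refine (enorm_add_le _ _).trans (add_le_add le_rfl ?_)
        rw [← ofReal_norm, norm_sub_rev, Real.norm_eq_abs]
        exact ENNReal.ofReal_le_ofReal (hp u hu).le
    _ = (∫⁻ u in Icc a b, ‖h u - g u‖ₑ) + ENNReal.ofReal (ε / 2) := by
        rw [lintegral_add_right _ measurable_const, setLIntegral_const, Real.volume_Icc,
          ← ENNReal.ofReal_mul hδ.le, div_mul_cancel₀ _ (sub_pos.2 hab).ne']
    _ ≤ ENNReal.ofReal (ε / 2) + ENNReal.ofReal (ε / 2) := by gcongr
    _ = ENNReal.ofReal ε := by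
        rw [← ENNReal.ofReal_add (half_pos hε).le (half_pos hε).le, add_halves]

/-- A convex function of a linear coordinate belongs to `AC(σ)`: approximating its slope by
polynomials in `L¹` approximates the function in the variation norm. -/
theorem isAC_comp_height_of_convexOn {σ : Set ℂ} (hσ : Bornology.IsBounded σ) (n : ℂ) {a b : ℝ}
    (hab : a < b) (hn : ∀ z ∈ σ, height n 0 z ∈ Icc a b) {k : ℝ → ℝ}
    (hk : ConvexOn ℝ (Icc a b) k) (hc : ContinuousOn k (Icc a b)) :
    IsAC (fun z : σ => (k (height n 0 z) : ℂ)) := by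
  obtain ⟨h, hh, hint⟩ := exists_integrableOn_integral_eq_sub hab hk hc
  refine isAC_of_forall_exists_bvENorm_sub_le fun ε hε => ?_
  obtain ⟨p, hp⟩ := exists_polynomial_lintegral_sub_le hab hh (half_pos hε)
  obtain ⟨P, rfl⟩ := exists_derivative_eq p
  set μ : Measure ℝ := (volume.restrict (Icc a b)).withDensity
    fun u => ‖h u - P.derivative.eval u‖ₑ with hμ
  have hμu : μ univ ≤ ENNReal.ofReal (ε / 2) := by
    rwa [hμ, withDensity_apply _ MeasurableSet.univ, Measure.restrict_univ]
  set d : ℝ → ℝ := fun t => k t - P.eval t with hd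
  have hinc : ∀ s ∈ Icc a b, ∀ t ∈ Icc a b, s ≤ t →
      ENNReal.ofReal |d t - d s| ≤ μ (Ioo s t) := by
    intro s hs t ht hst
    have hsub : Icc s t ⊆ Icc a b := Icc_subset_Icc hs.1 ht.2
    have hI : IntervalIntegrable h volume s t := by
      rw [intervalIntegrable_iff_integrableOn_Ioc_of_le hst]
      exact hh.mono_set (Ioc_subset_Icc_self.trans hsub)
    have hP : ∫ u in s..t, P.derivative.eval u = P.eval t - P.eval s :=
      intervalIntegral.integral_eq_sub_of_hasDerivAt (fun u _ => P.hasDerivAt u)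
        (P.derivative.continuous.intervalIntegrable _ _)
    have e : d t - d s = ∫ u in Ioo s t, (h u - P.derivative.eval u) := by
      rw [← integral_Ioc_eq_integral_Ioo, ← intervalIntegral.integral_of_le hst,
        intervalIntegral.integral_sub hI (P.derivative.continuous.intervalIntegrable _ _),
        hint s hs t ht hst, hP]
      simp only [hd]; ring
    rw [e, hμ, withDensity_apply _ measurableSet_Ioo, Measure.restrict_restrict measurableSet_Ioo,
      inter_eq_left.2 (Ioo_subset_Icc_self.trans hsub), ← Real.norm_eq_abs, ofReal_norm]
    exact enorm_integral_le_lintegral_enorm _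
  have ha : a ∈ Icc a b := left_mem_Icc.2 hab.le
  refine ⟨Polynomial.aeval (fun z : σ => (height n 0 z : ℂ)) (P.map Complex.ofRealHom) +
    fun _ => (d a : ℂ), ((isAC_height hσ n 0).aeval _).add (isAC_const _), ?_⟩
  have hfun : (fun z : σ => (k (height n 0 z) : ℂ)) -
      (Polynomial.aeval (fun z : σ => (height n 0 z : ℂ)) (P.map Complex.ofRealHom) +
        fun _ => (d a : ℂ)) = fun z : σ => ((d (height n 0 z) - d a : ℝ) : ℂ) := by
    funext z
    have : Polynomial.eval (height n 0 z : ℂ) (P.map Complex.ofRealHom) =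
        ((P.eval (height n 0 z) : ℝ) : ℂ) := by
      rw [Polynomial.eval_map, ← Complex.ofRealHom_eq_coe, ← Complex.ofRealHom_eq_coe,
        Polynomial.eval₂_at_apply]
    simp only [Pi.sub_apply, Pi.add_apply, Polynomial.aeval_fn_apply, Polynomial.coe_aeval_eq_eval,
      this, hd]
    push_cast; ring
  rw [hfun, ← add_halves ε, ENNReal.ofReal_add (half_pos hε).le (half_pos hε).le]
  refine add_le_add (iSup_le fun z => ?_) ?_
  · rw [← ofReal_norm, Complex.norm_real, Real.norm_eq_abs]
    exact ((hinc a ha _ (hn z z.2) (hn z z.2).1).trans (measure_mono (subset_univ _))).trans hμu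
  · refine (var_le_measure_univ n _ μ fun z w => ?_).trans hμu
    rw [edist_ofReal, sub_sub_sub_cancel_right, uIoo]
    rcases le_total (height n 0 z) (height n 0 w) with hzw | hzw
    · rw [inf_eq_left.2 hzw, sup_eq_right.2 hzw]
      exact hinc _ (hn z z.2) _ (hn w w.2) hzw
    · rw [inf_eq_right.2 hzw, sup_eq_left.2 hzw, abs_sub_comm]
      exact hinc _ (hn w w.2) _ (hn z z.2) hzw

theorem isAC_comp_height_of_concaveOn {σ : Set ℂ} (hσ : Bornology.IsBounded σ) (n : ℂ) {a b : ℝ}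
    (hab : a < b) (hn : ∀ z ∈ σ, height n 0 z ∈ Icc a b) {k : ℝ → ℝ}
    (hk : ConcaveOn ℝ (Icc a b) k) (hc : ContinuousOn k (Icc a b)) :
    IsAC (fun z : σ => (k (height n 0 z) : ℂ)) := by
  have := (isAC_const (-1)).mul (isAC_comp_height_of_convexOn hσ n hab hn hk.neg hc.neg)
  convert this using 1
  funext z
  simp

section

/-! ### Changing the domain -/

variable {σ τ υ : Set ℂ}

/-- An injective map `φ : σ → τ` whose coordinates belong to `AC(σ)` and which increases variation
factors at most by a constant factor. Composition with `φ` maps `AC(τ)` to `AC(σ)`. -/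
structure IsACMap (φ : σ → τ) : Prop where
  injective : Function.Injective φ
  exists_vf_le : ∃ C : ℕ, ∀ (x : ℕ → σ) (m : ℕ),
    vf (fun i => (φ (x i) : ℂ)) m ≤ C * vf (fun i => (x i : ℂ)) m
  isAC_re : IsAC (fun z => ((φ z : ℂ).re : ℂ))
  isAC_im : IsAC (fun z => ((φ z : ℂ).im : ℂ))

theorem cvar_le_var_mul_vf (g : τ → ℂ) {m : ℕ} {x : ℕ → τ} (hx : ∀ i < m, x i ≠ x (i + 1)) :
    cvar g x m ≤ var g * vf (fun i => (x i : ℂ)) m := by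
  rcases Nat.eq_zero_or_pos m with rfl | hm
  · simp [cvar]
  · have h0 : (vf (fun i => (x i : ℂ)) m : ℝ≥0∞) ≠ 0 :=
      Nat.cast_ne_zero.2 (Nat.one_le_iff_ne_zero.1 (one_le_vf _ hm))
    exact (ENNReal.div_le_iff h0 (ENNReal.natCast_ne_top _)).1 (le_var g hx)

theorem bvENorm_comp_le {φ : σ → τ} (hφ : Function.Injective φ) {C : ℕ}
    (hC : ∀ (x : ℕ → σ) (m : ℕ),
      vf (fun i => (φ (x i) : ℂ)) m ≤ C * vf (fun i => (x i : ℂ)) m) (g : τ → ℂ) :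
    bvENorm (g ∘ φ) ≤ (C + 1) * bvENorm g := by
  have hv : var (g ∘ φ) ≤ C * var g := by
    refine var_le_of_cvar_le fun m x hx => ENNReal.div_le_of_le_mul ?_
    calc cvar (g ∘ φ) x m = cvar g (fun i => φ (x i)) m := rfl
      _ ≤ var g * vf (fun i => (φ (x i) : ℂ)) m :=
        cvar_le_var_mul_vf g fun i hi h => hx i hi (hφ h)
      _ ≤ var g * (C * vf (fun i => (x i : ℂ)) m) := by
        gcongr
        exact_mod_cast hC x m
      _ = C * var g * vf (fun i => (x i : ℂ)) m := by ring
  have hs : (⨆ z, ‖(g ∘ φ) z‖ₑ) ≤ ⨆ z, ‖g z‖ₑ := iSup_le fun z => enorm_le_sup g (φ z)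
  calc bvENorm (g ∘ φ) ≤ (⨆ z, ‖g z‖ₑ) + C * var g := add_le_add hs hv
    _ ≤ (⨆ z, ‖g z‖ₑ) + C * var g + (C * (⨆ z, ‖g z‖ₑ) + var g) := le_self_add
    _ = (C + 1) * bvENorm g := by unfold bvENorm; ring

namespace IsACMap

/-- Composition with `φ`, as a homomorphism of variation algebras. -/
def compBV {φ : σ → τ} (hφ : IsACMap φ) : BV τ →ₐ[ℂ] BV σ where
  toFun g := (⟨BV.toFun τ g ∘ φ, by
    obtain ⟨C, hC⟩ := hφ.exists_vf_le
    exact (bvENorm_comp_le hφ.injective hC _).trans_lt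
      (ENNReal.mul_lt_top (by simp) g.bvENorm_lt_top)⟩ : bvSubalgebra σ)
  map_one' := rfl
  map_mul' _ _ := rfl
  map_zero' := rfl
  map_add' _ _ := rfl
  commutes' _ := rfl

theorem toFun_compBV {φ : σ → τ} (hφ : IsACMap φ) (g : BV τ) :
    BV.toFun σ (hφ.compBV g) = BV.toFun τ g ∘ φ := rfl

theorem continuous_compBV {φ : σ → τ} (hφ : IsACMap φ) : Continuous hφ.compBV := by
  obtain ⟨C, hC⟩ := hφ.exists_vf_le
  refine AddMonoidHomClass.continuous_of_bound hφ.compBV (C + 1) fun g => ?_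
  have h := ENNReal.toReal_mono (ENNReal.mul_lt_top (by simp) g.bvENorm_lt_top).ne
    (bvENorm_comp_le hφ.injective hC (BV.toFun τ g))
  rw [ENNReal.toReal_mul, ENNReal.toReal_add (by simp) (by simp)] at h
  simpa [BV.norm_def, toFun_compBV] using h

theorem compBV_mem {φ : σ → τ} (hφ : IsACMap φ) {g : BV τ} (hg : g ∈ AC τ) :
    hφ.compBV g ∈ AC σ := by
  let R : (τ → ℂ) →ₐ[ℂ] (σ → ℂ) := AlgHom.pi fun z => Pi.evalAlgHom ℂ _ (φ z)
  have hpoly : polyFun τ ≤ (acSubalgebra σ).comap R := by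
    rw [polyFun, ← Algebra.adjoin_range_eq_range_aeval]
    refine Algebra.adjoin_le ?_
    rintro _ ⟨i, rfl⟩
    refine mem_acSubalgebra.2 ?_
    fin_cases i
    · exact hφ.isAC_re
    · exact hφ.isAC_im
  have hle : AC τ ≤ (AC σ).comap hφ.compBV := by
    refine Subalgebra.topologicalClosure_minimal (fun G hG => ?_)
      ((Subalgebra.isClosed_topologicalClosure _).preimage hφ.continuous_compBV)
    obtain ⟨F, hF, e⟩ := isAC_iff.1 (mem_acSubalgebra.1 (hpoly hG))
    rw [Subalgebra.mem_comap]
    have : F = hφ.compBV G := BV.toFun_injective σ e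
    rwa [← this]
  exact hle hg

/-- Composition with `φ`, as a homomorphism of algebras of absolutely continuous functions. -/
def compAC {φ : σ → τ} (hφ : IsACMap φ) : AC τ →ₐ[ℂ] AC σ :=
  (hφ.compBV.comp (AC τ).val).codRestrict (AC σ) fun g => hφ.compBV_mem g.2

theorem acFun_compAC {φ : σ → τ} (hφ : IsACMap φ) (g : AC τ) :
    acFun (hφ.compAC g) = acFun g ∘ φ := rfl

theorem continuous_compAC {φ : σ → τ} (hφ : IsACMap φ) : Continuous hφ.compAC :=
  (hφ.continuous_compBV.comp continuous_subtype_val).subtype_mk _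

theorem isAC_comp {φ : σ → τ} (hφ : IsACMap φ) {g : τ → ℂ} (hg : IsAC g) : IsAC (g ∘ φ) := by
  obtain ⟨G, rfl⟩ := hg
  exact ⟨hφ.compAC G, hφ.acFun_compAC G⟩

theorem comp {ψ : τ → υ} {φ : σ → τ} (hψ : IsACMap ψ) (hφ : IsACMap φ) : IsACMap (ψ ∘ φ) where
  injective := hψ.injective.comp hφ.injective
  exists_vf_le := by
    obtain ⟨C, hC⟩ := hφ.exists_vf_le
    obtain ⟨D, hD⟩ := hψ.exists_vf_le
    refine ⟨D * C, fun x m => (hD (fun i => φ (x i)) m).trans ?_⟩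
    rw [mul_assoc]
    exact Nat.mul_le_mul_left D (hC x m)
  isAC_re := hφ.isAC_comp hψ.isAC_re
  isAC_im := hφ.isAC_comp hψ.isAC_im

end IsACMap

/-- A bijection `e : σ ≃ τ` with `IsACMap` in both directions, so that `g ↦ g ∘ e` is an isomorphism
from `AC(τ)` onto `AC(σ)`. -/
structure IsACEquiv (e : σ ≃ τ) : Prop where
  isACMap : IsACMap e
  isACMap_symm : IsACMap e.symm

namespace IsACEquiv

theorem trans {e : σ ≃ τ} {f : τ ≃ υ} (he : IsACEquiv e) (hf : IsACEquiv f) :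
    IsACEquiv (e.trans f) :=
  ⟨hf.isACMap.comp he.isACMap, he.isACMap_symm.comp hf.isACMap_symm⟩

theorem symm {e : σ ≃ τ} (he : IsACEquiv e) : IsACEquiv e.symm :=
  ⟨he.isACMap_symm, he.isACMap⟩

/-- Composition with `e`, as an isomorphism of Banach algebras. -/
def acEquiv {e : σ ≃ τ} (he : IsACEquiv e) : AC τ ≃A[ℂ] AC σ :=
  { AlgEquiv.ofAlgHom he.isACMap.compAC he.isACMap_symm.compAC
      (AlgHom.ext fun g => acFun_injective (by
        rw [AlgHom.comp_apply, IsACMap.acFun_compAC, IsACMap.acFun_compAC, Function.comp_assoc,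
          e.symm_comp_self]
        rfl))
      (AlgHom.ext fun g => acFun_injective (by
        rw [AlgHom.comp_apply, IsACMap.acFun_compAC, IsACMap.acFun_compAC, Function.comp_assoc,
          e.self_comp_symm]
        rfl)) with
    continuous_toFun := he.isACMap.continuous_compAC
    continuous_invFun := he.isACMap_symm.continuous_compAC }

theorem acFun_acEquiv {e : σ ≃ τ} (he : IsACEquiv e) (g : AC τ) :
    acFun (he.acEquiv g) = acFun g ∘ e := rfl

theorem isAC_comp_iff {e : σ ≃ τ} (he : IsACEquiv e) {g : τ → ℂ} : IsAC (g ∘ e) ↔ IsAC g := by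
  refine ⟨fun h => ?_, he.isACMap.isAC_comp⟩
  have := he.isACMap_symm.isAC_comp h
  rwa [Function.comp_assoc, e.self_comp_symm] at this

end IsACEquiv

end

section

variable {σ τ : Set ℂ}

/-! ### Affine and projective maps -/

theorem isACMap_affine {φ : σ → τ} (hσ : Bornology.IsBounded σ) {a b : ℂ} (ha : a ≠ 0)
    (h : ∀ z, (φ z : ℂ) = a * z + b) : IsACMap φ where
  injective z w hzw := by
    have := congrArg Subtype.val hzw
    rw [h, h] at this
    exact Subtype.ext (mul_left_cancel₀ ha (add_right_cancel this))
  exists_vf_le := by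
    refine ⟨1, fun x m => ?_⟩
    rw [one_mul]
    refine vf_comp_le_of_height_eq (fun n r => ?_) x m
    refine ⟨⟨n.re * a.re + n.im * a.im, n.im * a.re - n.re * a.im⟩, r - height n 0 b,
      fun z => ⟨1, one_pos, ?_⟩⟩
    simp [height, h]; ring
  isAC_re := by
    convert isAC_height hσ ⟨a.re, -a.im⟩ (-b.re) using 3 with z
    simp [height, h]; ring
  isAC_im := by
    convert isAC_height hσ ⟨a.im, a.re⟩ (-b.im) using 3 with z
    simp [height, h]; ring

/-- The projective transformation `(x, y) ↦ ((x + ε y / 2) / (1 + ε y), y / (1 + ε y))`. It fixes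
the real axis pointwise and, if `ε ≠ 0`, sends the vertical lines to the lines through `1 / 2 + i / ε`. -/
def perspective (ε : ℝ) (z : ℂ) : ℂ :=
  ⟨(z.re + ε * z.im / 2) / (1 + ε * z.im), z.im / (1 + ε * z.im)⟩

theorem one_sub_mul_perspective_im {ε : ℝ} {z : ℂ} (h : 1 + ε * z.im ≠ 0) :
    1 + -ε * (perspective ε z).im = (1 + ε * z.im)⁻¹ := by
  simp only [perspective]
  field_simp
  ring

theorem perspective_neg_perspective {ε : ℝ} {z : ℂ} (h : 1 + ε * z.im ≠ 0) :
    perspective (-ε) (perspective ε z) = z := by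
  have h1 := one_sub_mul_perspective_im h
  refine Complex.ext ?_ ?_
  · rw [perspective, h1]
    simp only [perspective]
    field_simp
    ring
  · rw [perspective, h1]
    simp only [perspective]
    rw [div_inv_eq_mul, div_mul_cancel₀ _ h]

/-- A projective transformation pulls lines back to lines, sides included. -/
theorem height_perspective (n : ℂ) (r : ℝ) {ε : ℝ} {z : ℂ} (h : 1 + ε * z.im ≠ 0) :
    height n r (perspective ε z) =
      (1 + ε * z.im)⁻¹ * height ⟨n.re, n.im + ε * n.re / 2 - ε * r⟩ r z := by
  simp only [height, perspective]
  field_simp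
  ring

/-- The denominator of a perspective is invertible in `AC(σ)`, because `t ↦ (1 + t)⁻¹` is convex. -/
theorem isAC_inv_one_add (hσ : Bornology.IsBounded σ) {ε δ : ℝ} (hδ : 0 < δ)
    (h : ∀ z ∈ σ, δ ≤ 1 + ε * z.im) : IsAC (fun z : σ => (((1 + ε * (z : ℂ).im)⁻¹ : ℝ) : ℂ)) := by
  obtain ⟨M, hM⟩ := hσ.exists_norm_le
  have hb : ∀ z ∈ σ, height ⟨0, ε⟩ 0 z ∈ Icc (δ - 1) (max δ (|ε| * M)) := fun z hz => by
    have e : height ⟨0, ε⟩ 0 z = ε * z.im := by simp [height]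
    rw [e]
    refine ⟨by linarith [h z hz], le_max_of_le_right ((le_abs_self _).trans ?_)⟩
    rw [abs_mul]
    exact mul_le_mul_of_nonneg_left ((Complex.abs_im_le_norm z).trans (hM z hz)) (abs_nonneg ε)
  have hab : δ - 1 < max δ (|ε| * M) := lt_max_of_lt_left (by linarith)
  have hpos : ∀ t ∈ Icc (δ - 1) (max δ (|ε| * M)), 0 < 1 + t := fun t ht => by
    linarith [ht.1]
  have hk : ConvexOn ℝ (Icc (δ - 1) (max δ (|ε| * M))) fun t => (1 + t)⁻¹ := by
    have := ((convexOn_zpow (𝕜 := ℝ) (-1)).translate_right 1).subset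
      (fun t ht => hpos t ht) (convex_Icc (δ - 1) (max δ (|ε| * M)))
    simpa [Function.comp_def] using this
  have hc : ContinuousOn (fun t : ℝ => (1 + t)⁻¹) (Icc (δ - 1) (max δ (|ε| * M))) :=
    ContinuousOn.inv₀ (by fun_prop) fun t ht => (hpos t ht).ne'
  convert isAC_comp_height_of_convexOn hσ ⟨0, ε⟩ hab hb hk hc using 3 with z
  simp [height]

theorem isACMap_perspective {φ : σ → τ} (hσ : Bornology.IsBounded σ) {ε δ : ℝ} (hδ : 0 < δ)
    (hpos : ∀ z ∈ σ, δ ≤ 1 + ε * z.im) (h : ∀ z, (φ z : ℂ) = perspective ε z) : IsACMap φ where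
  injective z w hzw := by
    have := congrArg (fun z : τ => perspective (-ε) z) hzw
    simp only [h] at this
    rw [perspective_neg_perspective (hδ.trans_le (hpos z z.2)).ne',
      perspective_neg_perspective (hδ.trans_le (hpos w w.2)).ne'] at this
    exact Subtype.ext this
  exists_vf_le := by
    refine ⟨1, fun x m => ?_⟩
    rw [one_mul]
    refine vf_comp_le_of_height_eq (fun n r =>
      ⟨⟨n.re, n.im + ε * n.re / 2 - ε * r⟩, r, fun z => ?_⟩) x m
    have hz := hδ.trans_le (hpos z z.2)
    exact ⟨_, inv_pos.2 hz, by rw [h, height_perspective n r hz.ne']⟩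
  isAC_re := by
    convert (isAC_height hσ ⟨1, ε / 2⟩ 0).mul (isAC_inv_one_add hσ hδ hpos) using 1
    funext z
    simp only [h, perspective, height, Pi.mul_apply]
    push_cast
    ring
  isAC_im := by
    convert (isAC_im hσ).mul (isAC_inv_one_add hσ hδ hpos) using 1
    funext z
    simp only [h, perspective, Pi.mul_apply]
    push_cast
    ring

/-! ### Graphs of convex functions -/

theorem exists_zero_mem_Ioo_of_mul_neg {F : ℝ → ℝ} {s t : ℝ} (hst : s < t)
    (hF : ContinuousOn F (Icc s t)) (h : F s * F t < 0) : ∃ u ∈ Ioo s t, F u = 0 := by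
  rcases mul_neg_iff.1 h with ⟨h1, h2⟩ | ⟨h1, h2⟩
  · exact intermediate_value_Ioo' hst.le hF ⟨h2, h1⟩
  · exact intermediate_value_Ioo hst.le hF ⟨h1, h2⟩

/-- A convex function enters its zero set or changes its sign only across the two ends of the
interval where it is nonpositive. -/
theorem exists_crossing_ends_of_convexOn {F : ℝ → ℝ} {I : Set ℝ} (hI : IsCompact I)
    (hF : ConvexOn ℝ I F) (hc : ContinuousOn F I) :
    ∃ a b : ℝ, ∀ s ∈ I, ∀ t ∈ I, (F s * F t < 0 ∨ (F s ≠ 0 ∧ F t = 0)) →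
      ((s - a) * (t - a) < 0 ∨ (s - a ≠ 0 ∧ t - a = 0)) ∨
      ((s - b) * (t - b) < 0 ∨ (s - b ≠ 0 ∧ t - b = 0)) := by
  set S : Set ℝ := {t ∈ I | F t ≤ 0} with hS
  have hconn : OrdConnected I := hF.1.ordConnected
  rcases S.eq_empty_or_nonempty with hemp | hne
  · have hpos : ∀ t ∈ I, 0 < F t := fun t ht => by
      by_contra hcon
      exact (hemp ▸ (show t ∈ S from ⟨ht, not_lt.1 hcon⟩) : t ∈ (∅ : Set ℝ))
    refine ⟨0, 0, fun s hs t ht h => ?_⟩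
    rcases h with h | h
    · exact absurd h (not_lt.2 (mul_pos (hpos s hs) (hpos t ht)).le)
    · exact absurd h.2 (hpos t ht).ne'
  · have hScomp : IsCompact S := by
      refine hI.of_isClosed_subset ?_ (sep_subset _ _)
      exact hc.preimage_isClosed_of_isClosed hI.isClosed isClosed_Iic
    obtain ⟨a, haS, ha⟩ := hScomp.exists_isLeast hne
    obtain ⟨b, hbS, hb⟩ := hScomp.exists_isGreatest hne
    have hout : ∀ p ∈ I, 0 < F p → p < a ∨ b < p := by
      intro p hp hFp
      by_contra! hcon
      exact absurd ((hF.convex_le 0).ordConnected.out haS hbS ⟨hcon.1, hcon.2⟩).2 (not_le.2 hFp)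
    have hneg : ∀ s ∈ S, F s < 0 → ∀ t ∈ I, F t = 0 → t = a ∨ t = b := by
      intro s hs hFs t ht hFt
      have key : ∀ q ∈ S, t ∈ openSegment ℝ s q → False := by
        rintro q hq ⟨α, β, hα, hβ, hαβ, rfl⟩
        have h1 := hF.2 hs.1 hq.1 hα.le hβ.le hαβ
        rw [hFt] at h1
        have h2 : α * F s < 0 := mul_neg_of_pos_of_neg hα hFs
        have h3 : β * F q ≤ 0 := mul_nonpos_of_nonneg_of_nonpos hβ.le hq.2
        simp only [smul_eq_mul] at h1
        linarith
      have htS : t ∈ S := ⟨ht, hFt.le⟩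
      by_contra! hcon
      have hat := lt_of_le_of_ne (ha htS) hcon.1.symm
      have htb := lt_of_le_of_ne (hb htS) hcon.2
      rcases lt_trichotomy s t with h | h | h
      · refine key b hbS ?_
        rw [openSegment_eq_Ioo (h.trans htb)]
        exact ⟨h, htb⟩
      · rw [h] at hFs
        exact hFs.ne hFt
      · refine key a haS ?_
        rw [openSegment_symm, openSegment_eq_Ioo (hat.trans h)]
        exact ⟨hat, h⟩
    have hzero : ∀ s ∈ I, ∀ t ∈ I, s < t → F s * F t < 0 → ∃ u ∈ Ioo s t, u ∈ S := by
      intro s hs t ht hst h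
      have hsub := hconn.out hs ht
      obtain ⟨u, hu, hFu⟩ := exists_zero_mem_Ioo_of_mul_neg hst (hc.mono hsub) h
      exact ⟨u, hu, hsub (Ioo_subset_Icc_self hu), hFu.le⟩
    have hcross : ∀ s ∈ I, ∀ t ∈ I, s < t → F s * F t < 0 →
        (s < a ∧ a < t) ∨ (s < b ∧ b < t) := by
      intro s hs t ht hst h
      obtain ⟨u, hu, huS⟩ := hzero s hs t ht hst h
      have h1 := ha huS
      have h2 := hb huS
      rcases mul_neg_iff.1 h with h' | h'
      · rcases hout s hs h'.1 with h3 | h3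
        · exact Or.inl ⟨h3, h1.trans_lt hu.2⟩
        · linarith [hu.1]
      · rcases hout t ht h'.2 with h3 | h3
        · linarith [hu.2]
        · exact Or.inr ⟨hu.1.trans_le h2, h3⟩
    refine ⟨a, b, fun s hs t ht h => ?_⟩
    rcases h with h | ⟨h1, h2⟩
    · rcases lt_trichotomy s t with hst | rfl | hst
      · rcases hcross s hs t ht hst h with h | h
        · exact Or.inl (Or.inl (mul_neg_of_neg_of_pos (by linarith) (by linarith)))
        · exact Or.inr (Or.inl (mul_neg_of_neg_of_pos (by linarith) (by linarith)))
      · exact absurd h (not_lt.2 (mul_self_nonneg _))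
      · rw [mul_comm] at h
        rcases hcross t ht s hs hst h with h | h
        · exact Or.inl (Or.inl (mul_neg_of_pos_of_neg (by linarith) (by linarith)))
        · exact Or.inr (Or.inl (mul_neg_of_pos_of_neg (by linarith) (by linarith)))
    · have htS : t ∈ S := ⟨ht, h2.le⟩
      rcases lt_or_gt_of_ne h1 with h1 | h1
      · have hne : s ≠ t := by
          rintro rfl
          exact h1.ne h2
        rcases hneg s ⟨hs, h1.le⟩ h1 t ht h2 with rfl | rfl
        · exact Or.inl (Or.inr ⟨sub_ne_zero.2 hne, sub_self _⟩)
        · exact Or.inr (Or.inr ⟨sub_ne_zero.2 hne, sub_self _⟩)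
      · rcases hout s hs h1 with h3 | h3
        · left
          rcases (ha htS).eq_or_lt with h4 | h4
          · exact Or.inr ⟨(sub_neg.2 h3).ne, by linarith⟩
          · exact Or.inl (mul_neg_of_neg_of_pos (by linarith) (by linarith))
        · right
          rcases (hb htS).eq_or_lt with h4 | h4
          · exact Or.inr ⟨(sub_pos.2 h3).ne', by linarith⟩
          · exact Or.inl (mul_neg_of_pos_of_neg (by linarith) (by linarith))

theorem exists_crossing_ends {F : ℝ → ℝ} {I : Set ℝ} (hI : IsCompact I)
    (hF : ConvexOn ℝ I F ∨ ConcaveOn ℝ I F) (hc : ContinuousOn F I) :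
    ∃ a b : ℝ, ∀ s ∈ I, ∀ t ∈ I, (F s * F t < 0 ∨ (F s ≠ 0 ∧ F t = 0)) →
      ((s - a) * (t - a) < 0 ∨ (s - a ≠ 0 ∧ t - a = 0)) ∨
      ((s - b) * (t - b) < 0 ∨ (s - b ≠ 0 ∧ t - b = 0)) := by
  rcases hF with hF | hF
  · exact exists_crossing_ends_of_convexOn hI hF hc
  · simpa using exists_crossing_ends_of_convexOn hI hF.neg hc.neg

variable {k : ℝ → ℝ}

theorem re_mem_Icc_of_mem_graphSet {p : ℂ} (hp : p ∈ graphSet k) : p.re ∈ Icc (0 : ℝ) 1 := by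
  obtain ⟨t, ht, rfl⟩ := hp
  exact ht

theorem im_eq_of_mem_graphSet {p : ℂ} (hp : p ∈ graphSet k) : p.im = k p.re := by
  obtain ⟨t, ht, rfl⟩ := hp
  rfl

/-- The projection of the graph of `k` onto the unit interval. -/
def graphEquiv (k : ℝ → ℝ) : graphSet k ≃ unitSeg where
  toFun p := ⟨(((p : ℂ).re : ℝ) : ℂ), re_mem_unitSeg p⟩
  invFun s := ⟨⟨(s : ℂ).re, k (s : ℂ).re⟩, by
    obtain ⟨_, t, ht, rfl⟩ := s
    exact ⟨t, ht, rfl⟩⟩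
  left_inv p := Subtype.ext (Complex.ext rfl (im_eq_of_mem_graphSet p.2).symm)
  right_inv s := by
    obtain ⟨_, t, ht, rfl⟩ := s
    rfl

theorem isBounded_graphSet (hc : ContinuousOn k (Icc 0 1)) : Bornology.IsBounded (graphSet k) := by
  have h : ContinuousOn (fun t : ℝ => (⟨t, k t⟩ : ℂ)) (Icc 0 1) := by
    have : (fun t : ℝ => (⟨t, k t⟩ : ℂ)) = fun t : ℝ => (t : ℂ) + k t * Complex.I := by
      funext t
      exact Complex.mk_eq_add_mul_I t (k t)
    rw [this]
    have hk : ContinuousOn (fun t => (k t : ℂ)) (Icc 0 1) :=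
      Complex.continuous_ofReal.comp_continuousOn hc
    fun_prop
  exact (isCompact_Icc.image_of_continuousOn h).isBounded

theorem isBounded_unitSeg : Bornology.IsBounded unitSeg :=
  (isCompact_Icc.image Complex.continuous_ofReal).isBounded

/-- A line meets the graph of a convex function in at most two points or in a segment, so a
crossing segment on it, unless it is the initial one, crosses one of two vertical lines. -/
theorem vf_graphSet_le (hk : ConvexOn ℝ (Icc 0 1) k ∨ ConcaveOn ℝ (Icc 0 1) k)
    (hc : ContinuousOn k (Icc 0 1)) (x : ℕ → graphSet k) (m : ℕ) :
    vf (fun i => (x i : ℂ)) m ≤ 3 * vf (fun i => (graphEquiv k (x i) : ℂ)) m := by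
  classical
  rcases Nat.eq_zero_or_pos m with rfl | hm
  · exact vf_le_of_vfLine_le fun n r _ => by simp [vfLine]
  refine vf_le_of_vfLine_le fun n r _ => ?_
  have hlin : ∀ c d : ℝ, ConvexOn ℝ (Icc (0 : ℝ) 1) (fun t => c * t + d) ∧
      ConcaveOn ℝ (Icc (0 : ℝ) 1) (fun t => c * t + d) := fun c d =>
    ⟨⟨convex_Icc _ _, fun x _ y _ a b _ _ hab => le_of_eq (by
      simp only [smul_eq_mul]; linear_combination (-d) * hab)⟩,
    ⟨convex_Icc _ _, fun x _ y _ a b _ _ hab => le_of_eq (by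
      simp only [smul_eq_mul]; linear_combination d * hab)⟩⟩
  have hF : ConvexOn ℝ (Icc 0 1) (fun t => (n.re * t + -r) + n.im * k t) ∨
      ConcaveOn ℝ (Icc 0 1) (fun t => (n.re * t + -r) + n.im * k t) := by
    have hneg : (fun t => n.im * k t) = fun t => -((-n.im) • k t) := by
      funext t; simp
    rcases hk with hk | hk <;> rcases le_total 0 n.im with hn | hn
    · exact Or.inl ((hlin _ _).1.add (hk.smul hn))
    · refine Or.inr ((hlin _ _).2.add ?_)
      rw [hneg]
      exact (hk.smul (neg_nonneg.2 hn)).neg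
    · exact Or.inr ((hlin _ _).2.add (hk.smul hn))
    · refine Or.inl ((hlin _ _).1.add ?_)
      rw [hneg]
      exact (hk.smul (neg_nonneg.2 hn)).neg
  obtain ⟨a, b, hab⟩ := exists_crossing_ends isCompact_Icc hF (by fun_prop)
  have hh : ∀ p : graphSet k,
      height n r p = (n.re * (p : ℂ).re + -r) + n.im * k (p : ℂ).re := fun p => by
    rw [height, im_eq_of_mem_graphSet p.2]; ring
  have hv : ∀ (c : ℝ) (p : graphSet k), height 1 c (graphEquiv k p) = (p : ℂ).re - c := fun c p => by
    simp [height, graphEquiv]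
  set A : Finset ℕ := {i ∈ Finset.range m | IsCrossing 1 a (fun i => (graphEquiv k (x i) : ℂ)) i}
  set B : Finset ℕ := {i ∈ Finset.range m | IsCrossing 1 b (fun i => (graphEquiv k (x i) : ℂ)) i}
  have hsub : {i ∈ Finset.range m | IsCrossing n r (fun i => (x i : ℂ)) i} ⊆ {0} ∪ (A ∪ B) := by
    intro i hi
    rw [Finset.mem_filter] at hi
    obtain ⟨him, hi⟩ := hi
    simp only [Finset.mem_union, Finset.mem_singleton, A, B, Finset.mem_filter, him, true_and]
    refine or_iff_not_imp_left.2 fun h0 => ?_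
    have hi' := hab _ (re_mem_Icc_of_mem_graphSet (x i).2) _
      (re_mem_Icc_of_mem_graphSet (x (i + 1)).2)
    rw [← hh, ← hh, ← hv, ← hv, ← hv, ← hv] at hi'
    simp only [IsCrossing] at hi ⊢
    tauto
  have h1 := one_le_vf (fun i => (graphEquiv k (x i) : ℂ)) hm
  have hA : A.card ≤ _ := vfLine_le_vf 1 a (fun i => (graphEquiv k (x i) : ℂ)) m
  have hB : B.card ≤ _ := vfLine_le_vf 1 b (fun i => (graphEquiv k (x i) : ℂ)) m
  have h2 := (Finset.card_le_card hsub).trans (Finset.card_union_le _ _)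
  have h3 := Finset.card_union_le A B
  rw [Finset.card_singleton] at h2
  unfold vfLine
  omega

theorem isACEquiv_graphEquiv (hk : ConvexOn ℝ (Icc 0 1) k ∨ ConcaveOn ℝ (Icc 0 1) k)
    (hc : ContinuousOn k (Icc 0 1)) : IsACEquiv (graphEquiv k) where
  isACMap :=
    { injective := (graphEquiv k).injective
      exists_vf_le := by
        refine ⟨1, fun x m => ?_⟩
        rw [one_mul]
        refine vf_comp_le_of_height_eq (fun n r => ⟨n.re, r, fun z => ⟨1, one_pos, ?_⟩⟩) x m
        simp [height, graphEquiv]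
      isAC_re := isAC_re (isBounded_graphSet hc)
      isAC_im := by
        convert isAC_const 0 using 2
        simp [graphEquiv] }
  isACMap_symm :=
    { injective := (graphEquiv k).symm.injective
      exists_vf_le := by
        refine ⟨3, fun x m => ?_⟩
        convert vf_graphSet_le hk hc (fun i => (graphEquiv k).symm (x i)) m using 5
        simp
      isAC_re := isAC_re isBounded_unitSeg
      isAC_im := by
        have hb : ∀ z ∈ unitSeg, height 1 0 z ∈ Icc (0 : ℝ) 1 := by
          rintro _ ⟨t, ht, rfl⟩
          simpa [height] using ht
        have : ∀ z : unitSeg, (((graphEquiv k).symm z : ℂ)).im = k (height 1 0 z) := fun z => by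
          simp [graphEquiv, height]
        simp only [this]
        rcases hk with hk | hk
        · exact isAC_comp_height_of_convexOn isBounded_unitSeg 1 one_pos hb hk hc
        · exact isAC_comp_height_of_concaveOn isBounded_unitSeg 1 one_pos hb hk hc }

end

section

/-! ### Arcs with supporting lines -/

/-- A simple arc from `x` to `y` with a supporting line through each of its points. -/
structure IsSupportedArc (c : Set ℂ) (x y : ℂ) : Prop where
  exists_param : ∃ (L : ℝ) (γ : ℝ → ℂ), 0 < L ∧ ContinuousOn γ (Icc 0 L) ∧ InjOn γ (Icc 0 L) ∧
    γ '' Icc 0 L = c ∧ γ 0 = x ∧ γ L = y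
  exists_support : ∀ z ∈ c, ∃ (n : ℂ) (r : ℝ), n ≠ 0 ∧ height n r z = 0 ∧ ∀ w ∈ c, 0 ≤ height n r w

theorem IsConvexCurve.isSupportedArc {c : Set ℂ} {x y : ℂ} (h : IsConvexCurve c x y) :
    IsSupportedArc c x y := by
  obtain ⟨⟨L, γ, hL, hc, hi, -, h1, h2, h3⟩, hs⟩ := h
  exact ⟨⟨L, γ, hL, hc, hi, h1, h2, h3⟩, hs⟩

namespace IsSupportedArc

variable {c : Set ℂ} {x y : ℂ}

theorem left_mem (h : IsSupportedArc c x y) : x ∈ c := by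
  obtain ⟨L, γ, hL, -, -, rfl, rfl, -⟩ := h.exists_param
  exact ⟨0, left_mem_Icc.2 hL.le, rfl⟩

theorem right_mem (h : IsSupportedArc c x y) : y ∈ c := by
  obtain ⟨L, γ, hL, -, -, rfl, -, rfl⟩ := h.exists_param
  exact ⟨L, right_mem_Icc.2 hL.le, rfl⟩

theorem ne (h : IsSupportedArc c x y) : x ≠ y := by
  obtain ⟨L, γ, hL, -, hi, -, rfl, rfl⟩ := h.exists_param
  exact fun e => hL.ne (hi (left_mem_Icc.2 hL.le) (right_mem_Icc.2 hL.le) e)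

theorem isCompact (h : IsSupportedArc c x y) : IsCompact c := by
  obtain ⟨L, γ, -, hc, -, rfl, -⟩ := h.exists_param
  exact isCompact_Icc.image_of_continuousOn hc

theorem reverse (h : IsSupportedArc c x y) : IsSupportedArc c y x := by
  refine ⟨?_, h.exists_support⟩
  obtain ⟨L, γ, hL, hc, hi, rfl, rfl, rfl⟩ := h.exists_param
  have hmaps : MapsTo (fun t => L - t) (Icc 0 L) (Icc 0 L) := fun t ht =>
    ⟨sub_nonneg.2 ht.2, sub_le_self _ ht.1⟩
  refine ⟨L, fun t => γ (L - t), hL, hc.comp (by fun_prop) hmaps, fun s hs t ht e => ?_, ?_,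
    by simp, by simp⟩
  · exact sub_right_injective (hi (hmaps hs) (hmaps ht) e)
  · refine Subset.antisymm ?_ ?_
    · rintro _ ⟨t, ht, rfl⟩
      exact ⟨L - t, hmaps ht, rfl⟩
    · rintro _ ⟨t, ht, rfl⟩
      exact ⟨L - t, hmaps ht, by simp⟩

theorem image (h : IsSupportedArc c x y) {F : ℂ → ℂ} (hF : ContinuousOn F c) (hi : InjOn F c)
    (hs : ∀ z ∈ c, ∀ (n : ℂ) (r : ℝ), n ≠ 0 → height n r z = 0 → (∀ w ∈ c, 0 ≤ height n r w) →
      ∃ (n' : ℂ) (r' : ℝ), n' ≠ 0 ∧ height n' r' (F z) = 0 ∧ ∀ w ∈ c, 0 ≤ height n' r' (F w)) :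
    IsSupportedArc (F '' c) (F x) (F y) := by
  refine ⟨?_, ?_⟩
  · obtain ⟨L, γ, hL, hc, hγ, rfl, rfl, rfl⟩ := h.exists_param
    have hm : MapsTo γ (Icc 0 L) (γ '' Icc 0 L) := mapsTo_image _ _
    exact ⟨L, F ∘ γ, hL, hF.comp hc hm, hi.comp hγ hm, image_comp _ _ _, rfl, rfl⟩
  · rintro _ ⟨z, hz, rfl⟩
    obtain ⟨n, r, hn, h0, hw⟩ := h.exists_support z hz
    obtain ⟨n', r', hn', h0', hw'⟩ := hs z hz n r hn h0 hw
    exact ⟨n', r', hn', h0', by rintro _ ⟨w, hwc, rfl⟩; exact hw' w hwc⟩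

theorem image_affine (h : IsSupportedArc c x y) {a : ℂ} (ha : a ≠ 0) (b : ℂ) :
    IsSupportedArc ((fun z => a * z + b) '' c) (a * x + b) (a * y + b) := by
  refine h.image (by fun_prop) (fun z _ w _ e => mul_left_cancel₀ ha (add_right_cancel e)) ?_
  intro z _ n r hn h0 hw
  set n' : ℂ := n * (starRingEnd ℂ a)⁻¹ with hn'
  have hn0 : n = n' * starRingEnd ℂ a := by
    rw [hn', inv_mul_cancel_right₀ ((map_ne_zero _).2 ha)]
  have hh : ∀ w, height n' (r + height n' 0 b) (a * w + b) = height n r w := fun w => by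
    rw [hn0]
    simp [height]; ring
  refine ⟨n', r + height n' 0 b, mul_ne_zero hn (inv_ne_zero ((map_ne_zero _).2 ha)), ?_, ?_⟩
  · rw [hh, h0]
  · exact fun w hwc => (hh w).symm ▸ hw w hwc

theorem image_conj (h : IsSupportedArc c x y) :
    IsSupportedArc (starRingEnd ℂ '' c) (starRingEnd ℂ x) (starRingEnd ℂ y) := by
  refine h.image Complex.continuous_conj.continuousOn (RingHom.injective _).injOn ?_
  intro z _ n r hn h0 hw
  have hh : ∀ w, height (starRingEnd ℂ n) r (starRingEnd ℂ w) = height n r w := fun w => by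
    simp [height]
  exact ⟨starRingEnd ℂ n, r, (map_ne_zero _).2 hn, by rw [hh, h0],
    fun w hwc => (hh w).symm ▸ hw w hwc⟩

/-- The intermediate value theorem on an arc; a zero lying strictly between two points of the arc
is not an end of it. -/
theorem exists_eq_zero (h : IsSupportedArc c x y) {f : ℂ → ℝ} (hf : Continuous f) {p q : ℂ}
    (hp : p ∈ c) (hq : q ∈ c) (hfp : f p < 0) (hfq : 0 < f q) :
    ∃ z ∈ c, z ≠ x ∧ z ≠ y ∧ f z = 0 := by
  obtain ⟨L, γ, hL, hc, hi, rfl, rfl, rfl⟩ := h.exists_param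
  have key : ∀ a ∈ Icc 0 L, ∀ b ∈ Icc 0 L, a < b → f (γ a) * f (γ b) < 0 →
      ∃ z ∈ γ '' Icc 0 L, z ≠ γ 0 ∧ z ≠ γ L ∧ f z = 0 := by
    intro a ha b hb hab hm
    obtain ⟨t, ht, h0⟩ := exists_zero_mem_Ioo_of_mul_neg (F := f ∘ γ) hab
      (hf.comp_continuousOn (hc.mono (Icc_subset_Icc ha.1 hb.2))) hm
    have htL : t ∈ Icc 0 L := ⟨ha.1.trans ht.1.le, ht.2.le.trans hb.2⟩
    refine ⟨γ t, ⟨t, htL, rfl⟩, fun e => ?_, fun e => ?_, h0⟩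
    · exact (ha.1.trans_lt ht.1).ne' (hi htL (left_mem_Icc.2 hL.le) e)
    · exact (ht.2.trans_le hb.2).ne (hi htL (right_mem_Icc.2 hL.le) e)
  obtain ⟨a, ha, rfl⟩ := hp
  obtain ⟨b, hb, rfl⟩ := hq
  rcases lt_trichotomy a b with hab | rfl | hab
  · exact key a ha b hb hab (mul_neg_of_neg_of_pos hfp hfq)
  · exact absurd hfp hfq.not_gt
  · exact key b hb a ha hab (mul_neg_of_pos_of_neg hfq hfp)

/-! ### Arcs in the strip over the chord `[0, 1]` -/

/-- A supporting line at an inner point of the chord contains the chord. So the arc passes from one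
side of the chord to the other only through its ends. -/
theorem forall_im_nonneg_or_forall_im_nonpos (h : IsSupportedArc c 0 1)
    (hstrip : ∀ z ∈ c, z.re ∈ Icc (0 : ℝ) 1) : (∀ z ∈ c, 0 ≤ z.im) ∨ (∀ z ∈ c, z.im ≤ 0) := by
  by_contra! hcon
  obtain ⟨⟨p, hp, hpi⟩, ⟨q, hq, hqi⟩⟩ := hcon
  obtain ⟨z, hz, hz0, hz1, hzi⟩ := h.exists_eq_zero Complex.continuous_im hp hq hpi hqi
  have ht0 : 0 < z.re := lt_of_le_of_ne (hstrip z hz).1 fun e => hz0 (Complex.ext e.symm hzi)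
  have ht1 : z.re < 1 := lt_of_le_of_ne (hstrip z hz).2 fun e => hz1 (Complex.ext e hzi)
  obtain ⟨n, r, hn, hnz, hw⟩ := h.exists_support z hz
  have h0 := hw 0 h.left_mem
  have h1 := hw 1 h.right_mem
  have hp' := hw p hp
  have hq' := hw q hq
  simp only [height, Complex.zero_re, Complex.zero_im, Complex.one_re, Complex.one_im, hzi]
    at hnz h0 h1 hp' hq'
  have hre : n.re = 0 := by nlinarith
  have hr : r = 0 := by rw [hre] at hnz; linarith
  rw [hre, hr] at hp' hq'
  exact hn (Complex.ext hre (by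
    rcases lt_trichotomy n.im 0 with hi | hi | hi
    · nlinarith
    · exact hi
    · nlinarith))

/-- A point of the arc that lies strictly inside the triangle with vertices `0`, `1` and another
point of the arc has no supporting line. An arc above its chord that touches the chord at an inner
point but does not stay in it would enter such a triangle. Hence the supporting lines of an arc
above its chord are on the upper side, except at the ends. -/
theorem exists_slope (h : IsSupportedArc c 0 1) (hre0 : ∀ z ∈ c, z ≠ 0 → 0 < z.re)
    (hre1 : ∀ z ∈ c, z ≠ 1 → z.re < 1) (him : ∀ z ∈ c, 0 ≤ z.im) {z : ℂ} (hz : z ∈ c)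
    (hz0 : z ≠ 0) (hz1 : z ≠ 1) : ∃ s : ℝ, ∀ w ∈ c, w.im ≤ z.im + s * (w.re - z.re) := by
  by_cases hall : ∀ q ∈ c, q.im ≤ 0
  · exact ⟨0, fun w hw => by rw [zero_mul, add_zero]; exact (hall w hw).trans (him z hz)⟩
  push Not at hall
  obtain ⟨q, hq, hqi⟩ := hall
  have hsupp : ∀ p ∈ c, p ≠ 0 → p ≠ 1 → 0 < p.im → ∃ n : ℂ, n.im < 0 ∧
      ∀ w ∈ c, 0 ≤ n.re * (w.re - p.re) + n.im * (w.im - p.im) := by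
    intro p hp hp0 hp1 hpi
    obtain ⟨n, r, hn, hnp, hw⟩ := h.exists_support p hp
    have hw' : ∀ w ∈ c, 0 ≤ n.re * (w.re - p.re) + n.im * (w.im - p.im) := fun w hwc => by
      have := hw w hwc
      simp only [height] at this hnp
      linarith
    refine ⟨n, ?_, hw'⟩
    have h0 := hw' 0 h.left_mem
    have h1 := hw' 1 h.right_mem
    have ht0 := hre0 p hp hp0
    have ht1 := hre1 p hp hp1
    simp only [Complex.zero_re, Complex.zero_im, Complex.one_re, Complex.one_im] at h0 h1
    by_contra! hni
    have hni0 : n.im = 0 := by nlinarith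
    rw [hni0] at h0 h1
    exact hn (Complex.ext (by rw [Complex.zero_re]; nlinarith) hni0)
  have hzi : 0 < z.im := by
    by_contra! hzi
    have hzi0 : z.im = 0 := le_antisymm hzi (him z hz)
    -- A point of the arc strictly between the chord and the other sides of the triangle `0, q, 1`.
    obtain ⟨p, hp, hp0, hp1, hpe⟩ := h.exists_eq_zero
      (f := fun w => w.im - q.im / 2 * min w.re (1 - w.re)) (by fun_prop) hz hq
      (by
        have : 0 < min z.re (1 - z.re) := lt_min (hre0 z hz hz0) (sub_pos.2 (hre1 z hz hz1))
        have := mul_pos (half_pos hqi) this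
        rw [hzi0]
        linarith)
      (by
        have h1 : q.re ≤ 1 := by
          rcases eq_or_ne q 1 with rfl | hq1
          · simp
          · exact (hre1 q hq hq1).le
        have : min q.re (1 - q.re) ≤ 1 := (min_le_left _ _).trans h1
        nlinarith)
    have ht0 := hre0 p hp hp0
    have ht1 := hre1 p hp hp1
    have hpm : 0 < min p.re (1 - p.re) := lt_min ht0 (sub_pos.2 ht1)
    have hpi : 0 < p.im := by nlinarith [mul_pos (half_pos hqi) hpm]
    obtain ⟨n, hni, hw⟩ := hsupp p hp hp0 hp1 hpi
    have h0 := hw 0 h.left_mem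
    have h1 := hw 1 h.right_mem
    have hq' := hw q hq
    simp only [Complex.zero_re, Complex.zero_im, Complex.one_re, Complex.one_im] at h0 h1
    have hq0 : 0 < q.re := hre0 q hq (by rintro rfl; simp at hqi)
    have hq1 : q.re < 1 := hre1 q hq (by rintro rfl; simp at hqi)
    rcases le_total p.re q.re with hpq | hpq
    · have hlow : q.re * p.im < p.re * q.im := by
        have : q.im / 2 * min p.re (1 - p.re) ≤ q.im / 2 * p.re :=
          mul_le_mul_of_nonneg_left (min_le_left _ _) (half_pos hqi).le
        have hpi' : p.im ≤ q.im / 2 * p.re := by linarith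
        nlinarith [mul_pos hqi ht0]
      have h2 := mul_nonneg (sub_nonneg.2 hpq) h0
      have h3 := mul_nonneg ht0.le hq'
      nlinarith
    · have hlow : (1 - q.re) * p.im < (1 - p.re) * q.im := by
        have : q.im / 2 * min p.re (1 - p.re) ≤ q.im / 2 * (1 - p.re) :=
          mul_le_mul_of_nonneg_left (min_le_right _ _) (half_pos hqi).le
        have hpi' : p.im ≤ q.im / 2 * (1 - p.re) := by linarith
        nlinarith [mul_pos hqi (sub_pos.2 ht1)]
      have h2 := mul_nonneg (sub_nonneg.2 hpq) h1
      have h3 := mul_nonneg (sub_nonneg.2 ht1.le) hq'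
      nlinarith
  obtain ⟨n, hni, hw⟩ := hsupp z hz hz0 hz1 hzi
  refine ⟨-n.re / n.im, fun w hwc => ?_⟩
  have e : z.im + -n.re / n.im * (w.re - z.re) - w.im =
      -(n.re * (w.re - z.re) + n.im * (w.im - z.im)) / n.im := by
    have := hni.ne
    field_simp
    ring
  have := div_nonneg_of_nonpos (neg_nonpos.2 (hw w hwc)) hni.le
  linarith

/-- The slopes show that the arc has one point over each inner point of the chord, and that the
resulting function is concave; it is continuous because the arc is compact. -/
theorem exists_concaveOn_eq_graphSet (h : IsSupportedArc c 0 1)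
    (hre0 : ∀ z ∈ c, z ≠ 0 → 0 < z.re) (hre1 : ∀ z ∈ c, z ≠ 1 → z.re < 1)
    (him : ∀ z ∈ c, 0 ≤ z.im) :
    ∃ H : ℝ → ℝ, ConcaveOn ℝ (Icc 0 1) H ∧ ContinuousOn H (Icc 0 1) ∧ c = graphSet H := by
  have hinj : ∀ z ∈ c, ∀ w ∈ c, z.re = w.re → z = w := by
    have hend : ∀ z ∈ c, ∀ w ∈ c, z.re = w.re → z ≠ 0 → z ≠ 1 → w ≠ 0 ∧ w ≠ 1 := by
      intro z hz w hw e hz0 hz1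
      constructor
      · rintro rfl
        exact (hre0 z hz hz0).ne' e
      · rintro rfl
        exact (hre1 z hz hz1).ne e
    have hle : ∀ z ∈ c, ∀ w ∈ c, z.re = w.re → z ≠ 0 → z ≠ 1 → w.im ≤ z.im := by
      intro z hz w hw e hz0 hz1
      obtain ⟨s, hs⟩ := h.exists_slope hre0 hre1 him hz hz0 hz1
      simpa [e] using hs w hw
    intro z hz w hw e
    rcases eq_or_ne z 0 with rfl | hz0
    · by_contra hw0
      exact (hre0 w hw (Ne.symm hw0)).ne e
    rcases eq_or_ne z 1 with rfl | hz1
    · by_contra hw1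
      exact (hre1 w hw (Ne.symm hw1)).ne' e
    obtain ⟨hw0, hw1⟩ := hend z hz w hw e hz0 hz1
    exact Complex.ext e (le_antisymm (hle w hw z hz e.symm hw0 hw1) (hle z hz w hw e hz0 hz1))
  have hsurj : ∀ t ∈ Icc (0 : ℝ) 1, ∃ u : ℝ, (⟨t, u⟩ : ℂ) ∈ c := by
    intro t ht
    rcases ht.1.eq_or_lt with rfl | ht0
    · exact ⟨0, h.left_mem⟩
    rcases ht.2.eq_or_lt with rfl | ht1
    · exact ⟨0, h.right_mem⟩
    obtain ⟨z, hz, -, -, e⟩ := h.exists_eq_zero (f := fun w => w.re - t) (by fun_prop)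
      h.left_mem h.right_mem (by simpa using ht0) (by simpa using ht1)
    refine ⟨z.im, ?_⟩
    rw [← sub_eq_zero.1 e]
    exact hz
  choose! H hH using hsurj
  have hc : c = graphSet H := by
    refine Subset.antisymm (fun z hz => ?_) ?_
    · have ht : z.re ∈ Icc (0 : ℝ) 1 := by
        constructor
        · rcases eq_or_ne z 0 with rfl | hz0
          · simp
          · exact (hre0 z hz hz0).le
        · rcases eq_or_ne z 1 with rfl | hz1
          · simp
          · exact (hre1 z hz hz1).le
      exact ⟨z.re, ht, hinj _ (hH _ ht) z hz rfl⟩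
    · rintro _ ⟨t, ht, rfl⟩
      exact hH t ht
  refine ⟨H, ⟨convex_Icc _ _, fun s hs t ht a b ha hb hab => ?_⟩, ?_, hc⟩
  · have hu : a * s + b * t ∈ Icc (0 : ℝ) 1 := convex_Icc (0 : ℝ) 1 hs ht ha hb hab
    simp only [smul_eq_mul]
    set u := a * s + b * t with hudef
    have hslope : ∃ m : ℝ, a * H s ≤ a * (H u + m * (s - u)) ∧
        b * H t ≤ b * (H u + m * (t - u)) := by
      have has := mul_nonneg ha hs.1
      have hbt := mul_nonneg hb ht.1
      have has' := mul_nonneg ha (sub_nonneg.2 hs.2)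
      have hbt' := mul_nonneg hb (sub_nonneg.2 ht.2)
      -- A convex combination that is an end of `[0, 1]` involves no other point of `[0, 1]`.
      have hdeg : ∀ a s : ℝ, a * (s - u) = 0 → a * H s ≤ a * (H u + 0 * (s - u)) := by
        intro a s e
        rcases mul_eq_zero.1 e with rfl | e
        · simp
        · rw [sub_eq_zero.1 e]; simp
      rcases hu.1.eq_or_lt with h0 | h0
      · exact ⟨0, hdeg a s (by rw [← h0]; linarith), hdeg b t (by rw [← h0]; linarith)⟩
      rcases hu.2.eq_or_lt with h1 | h1
      · exact ⟨0, hdeg a s (by rw [h1]; linarith), hdeg b t (by rw [h1]; linarith)⟩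
      · obtain ⟨m, hm⟩ := h.exists_slope hre0 hre1 him (hH u hu)
          (fun e => h0.ne' (congrArg Complex.re e)) (fun e => h1.ne (congrArg Complex.re e))
        exact ⟨m, mul_le_mul_of_nonneg_left (hm _ (hH s hs)) ha,
          mul_le_mul_of_nonneg_left (hm _ (hH t ht)) hb⟩
    obtain ⟨m, h1, h2⟩ := hslope
    have e : a * (H u + m * (s - u)) + b * (H u + m * (t - u)) = H u := by
      have hb' : b = 1 - a := by linarith
      rw [hudef, hb']
      ring
    linarith
  · refine continuousOn_iff_isClosed.2 fun B hB => ⟨Complex.re '' (c ∩ Complex.im ⁻¹' B), ?_, ?_⟩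
    · exact ((h.isCompact.inter_right (hB.preimage Complex.continuous_im)).image
        Complex.continuous_re).isClosed
    · ext t
      constructor
      · rintro ⟨htB, ht⟩
        exact ⟨⟨⟨t, H t⟩, ⟨hH t ht, htB⟩, rfl⟩, ht⟩
      · rintro ⟨⟨z, ⟨hz, hzB⟩, rfl⟩, ht⟩
        refine ⟨?_, ht⟩
        have e : (⟨z.re, H z.re⟩ : ℂ) = z := hinj _ (hH _ ht) z hz rfl
        rw [mem_preimage, show H z.re = z.im from congrArg Complex.im e]
        exact hzB

theorem exists_eq_graphSet (h : IsSupportedArc c 0 1) (hstrip : ∀ z ∈ c, z.re ∈ Icc (0 : ℝ) 1)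
    (hend0 : ∀ z ∈ c, z.re = 0 → z = 0) (hend1 : ∀ z ∈ c, z.re = 1 → z = 1) :
    ∃ H : ℝ → ℝ, (ConvexOn ℝ (Icc 0 1) H ∨ ConcaveOn ℝ (Icc 0 1) H) ∧
      ContinuousOn H (Icc 0 1) ∧ c = graphSet H := by
  have hre0 : ∀ z ∈ c, z ≠ 0 → 0 < z.re := fun z hz hne =>
    lt_of_le_of_ne (hstrip z hz).1 fun e => hne (hend0 z hz e.symm)
  have hre1 : ∀ z ∈ c, z ≠ 1 → z.re < 1 := fun z hz hne =>
    lt_of_le_of_ne (hstrip z hz).2 fun e => hne (hend1 z hz e)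
  rcases h.forall_im_nonneg_or_forall_im_nonpos hstrip with him | him
  · obtain ⟨H, h1, h2, h3⟩ := h.exists_concaveOn_eq_graphSet hre0 hre1 him
    exact ⟨H, Or.inr h1, h2, h3⟩
  · have h' := h.image_conj
    rw [map_zero, map_one] at h'
    obtain ⟨H, h1, h2, h3⟩ := h'.exists_concaveOn_eq_graphSet
      (by
        rintro _ ⟨z, hz, rfl⟩ hne
        exact hre0 z hz (by rintro rfl; simp at hne))
      (by
        rintro _ ⟨z, hz, rfl⟩ hne
        exact hre1 z hz (by rintro rfl; simp at hne))
      (by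
        rintro _ ⟨z, hz, rfl⟩
        simpa using him z hz)
    refine ⟨-H, Or.inl h1.neg, h2.neg, ?_⟩
    have hconj : ∀ t, starRingEnd ℂ ⟨t, H t⟩ = ⟨t, (-H) t⟩ := fun t => rfl
    ext z
    constructor
    · intro hz
      obtain ⟨t, ht, e⟩ : starRingEnd ℂ z ∈ graphSet H := h3 ▸ mem_image_of_mem _ hz
      exact ⟨t, ht, by rw [← Complex.conj_conj z, ← e]; rfl⟩
    · rintro ⟨t, ht, rfl⟩
      obtain ⟨w, hw, e⟩ : (⟨t, H t⟩ : ℂ) ∈ starRingEnd ℂ '' c := h3 ▸ ⟨t, ht, rfl⟩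
      have : w = ⟨t, (-H) t⟩ := by
        rw [← Complex.conj_conj w, e]; rfl
      rwa [this] at hw

/-- If the arc contains a second point `z` straight above or below its end `0`, it contains the
segment between them: otherwise the pieces of the arc from `0` to `z` and from `z` to `1` would pass
at the same height by two different points, the nearer of which would lie strictly inside the
triangle spanned by `0`, `z` and the farther one. -/
theorem segment_subset (h : IsSupportedArc c 0 1) (hre : ∀ z ∈ c, 0 ≤ z.re) {z : ℂ} (hz : z ∈ c)
    (hz0 : z.re = 0) : segment ℝ 0 z ⊆ c := by
  rw [segment_eq_image']
  rintro _ ⟨l, ⟨hl0, hl1⟩, rfl⟩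
  simp only [sub_zero, zero_add]
  by_contra hcon
  have hl0 : 0 < l := lt_of_le_of_ne hl0 (by rintro rfl; exact hcon (by simpa using h.left_mem))
  have hl1 : l < 1 := lt_of_le_of_ne hl1 (by rintro rfl; exact hcon (by simpa using hz))
  have hv : z.im ≠ 0 := fun e => hcon (by
    rw [show z = 0 from Complex.ext hz0 e, smul_zero]; exact h.left_mem)
  have hv2 : 0 < z.im * z.im := mul_self_pos.2 hv
  have hpos : ∀ p ∈ c, p.im = l * z.im → 0 < p.re := fun p hp hpi =>
    lt_of_le_of_ne (hre p hp) fun e => hcon (by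
      have : l • z = p := Complex.ext (by simp [hz0, ← e]) (by simp [hpi])
      rwa [this])
  have key : ∀ p ∈ c, ∀ q ∈ c, p.im = l * z.im → q.im = l * z.im → ¬ p.re < q.re := by
    intro p hp q hq hpi hqi hpq
    have hp0 := hpos p hp hpi
    obtain ⟨n, r, hn, hnp, hw⟩ := h.exists_support p hp
    have h0 := hw 0 h.left_mem
    have h1 := hw z hz
    have h2 := hw q hq
    simp only [height, Complex.zero_re, Complex.zero_im, hz0, hpi, hqi] at hnp h0 h1 h2
    have hA : n.re = 0 := by nlinarith
    rw [hA] at hnp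
    have hr : r = 0 := by nlinarith
    have hB : n.im * z.im = 0 := by
      have : l * (n.im * z.im) = 0 := by rw [hr] at hnp; linarith
      exact (mul_eq_zero.1 this).resolve_left hl0.ne'
    exact hn (Complex.ext hA ((mul_eq_zero.1 hB).resolve_right hv))
  obtain ⟨L, γ, hL, hc, hi, rfl, hγ0, hγL⟩ := h.exists_param
  obtain ⟨a, ha, rfl⟩ := hz
  set v := (γ a).im
  have hval : ∀ t, (γ a).im * (γ t).im - l * (v * v) = 0 → (γ t).im = l * v := fun t e => by
    have : v * ((γ t).im - l * v) = 0 := by rw [← e]; ring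
    exact sub_eq_zero.1 ((mul_eq_zero.1 this).resolve_left hv)
  have hfa : 0 < v * (γ a).im - l * (v * v) := by
    have : (1 - l) * (v * v) > 0 := mul_pos (sub_pos.2 hl1) hv2
    linarith
  have hf0 : v * (γ 0).im - l * (v * v) < 0 := by
    rw [hγ0, Complex.zero_im]
    nlinarith
  have hfL : v * (γ L).im - l * (v * v) < 0 := by
    rw [hγL, Complex.one_im]
    nlinarith
  have ha0 : 0 < a := lt_of_le_of_ne ha.1 (by rintro rfl; linarith)
  have haL : a < L := lt_of_le_of_ne ha.2 (by rintro rfl; linarith)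
  have hcont : ContinuousOn (fun t => v * (γ t).im - l * (v * v)) (Icc 0 L) :=
    (continuousOn_const.mul (Complex.continuous_im.comp_continuousOn hc)).sub continuousOn_const
  obtain ⟨s, hs, hse⟩ := exists_zero_mem_Ioo_of_mul_neg ha0
    (hcont.mono (Icc_subset_Icc_right ha.2)) (mul_neg_of_neg_of_pos hf0 hfa)
  obtain ⟨t, ht, hte⟩ := exists_zero_mem_Ioo_of_mul_neg haL
    (hcont.mono (Icc_subset_Icc_left ha.1)) (mul_neg_of_pos_of_neg hfa hfL)
  have hsL : s ∈ Icc 0 L := ⟨hs.1.le, hs.2.le.trans ha.2⟩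
  have htL : t ∈ Icc 0 L := ⟨ha.1.trans ht.1.le, ht.2.le⟩
  have hsi := hval s hse
  have hti := hval t hte
  rcases lt_trichotomy (γ s).re (γ t).re with hlt | heq | hlt
  · exact key _ ⟨s, hsL, rfl⟩ _ ⟨t, htL, rfl⟩ hsi hti hlt
  · exact (hs.2.trans ht.1).ne (hi hsL htL (Complex.ext heq (hsi.trans hti.symm)))
  · exact key _ ⟨t, htL, rfl⟩ _ ⟨s, hsL, rfl⟩ hti hsi hlt

/-- If the arc contains no segment orthogonal to its chord, it meets the lines orthogonal to the
chord at its ends only in these ends. -/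
theorem eq_ends_of_no_vertical_segment (h : IsSupportedArc c 0 1)
    (hstrip : ∀ z ∈ c, z.re ∈ Icc (0 : ℝ) 1)
    (hseg : ∀ z w : ℂ, z ≠ w → segment ℝ z w ⊆ c → z.re ≠ w.re) :
    (∀ z ∈ c, z.re = 0 → z = 0) ∧ (∀ z ∈ c, z.re = 1 → z = 1) := by
  constructor
  · intro z hz hz0
    by_contra hne
    exact hseg 0 z (Ne.symm hne) (h.segment_subset (fun w hw => (hstrip w hw).1) hz hz0)
      (by simp [hz0])
  · -- The half-turn about `1 / 2` exchanges the ends.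
    have h' := (h.image_affine (neg_ne_zero.2 one_ne_zero) 1).reverse
    simp only [mul_zero, zero_add, mul_one, neg_add_cancel] at h'
    intro z hz hz1
    by_contra hne
    have hsub := h'.segment_subset (z := -1 * z + 1)
      (by
        rintro _ ⟨w, hw, rfl⟩
        simpa using (hstrip w hw).2) ⟨z, hz, rfl⟩ (by simp [hz1])
    refine hseg 1 z (Ne.symm hne) (fun w hw => ?_) (by simp [hz1])
    rw [segment_eq_image'] at hw hsub
    obtain ⟨l, hl, rfl⟩ := hw
    obtain ⟨w, hw, e⟩ := hsub ⟨l, hl, rfl⟩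
    have : 1 + l • (z - 1) = w := by
      simp only [Complex.real_smul] at e ⊢
      linear_combination e
    rwa [← this] at hw

/-- The perspective turns the lines through `1 / 2 - i / ε`, a point on the other side of the chord,
into vertical lines. On the side of the arc, the two of these lines that pass through the ends of the
chord meet the strip over the chord only in these ends. -/
theorem perspective_image (h : IsSupportedArc c 0 1) (hstrip : ∀ z ∈ c, z.re ∈ Icc (0 : ℝ) 1)
    {ε : ℝ} (hε : ε ≠ 0) (him : ∀ z ∈ c, 0 ≤ ε * z.im) :
    IsSupportedArc (perspective ε '' c) 0 1 ∧
    (∀ z ∈ perspective ε '' c, z.re ∈ Icc (0 : ℝ) 1) ∧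
    (∀ z ∈ perspective ε '' c, z.re = 0 → z = 0) ∧
    (∀ z ∈ perspective ε '' c, z.re = 1 → z = 1) := by
  have hpos : ∀ z ∈ c, 0 < 1 + ε * z.im := fun z hz => by linarith [him z hz]
  refine ⟨?_, ?_, ?_, ?_⟩
  · have := h.image (F := perspective ε) ?_ ?_ ?_
    · have h0 : perspective ε 0 = 0 := by simp [perspective, Complex.ext_iff]
      have h1 : perspective ε 1 = 1 := by simp [perspective, Complex.ext_iff]
      rwa [h0, h1] at this
    · have e : perspective ε = fun z => ((z.re + ε * z.im / 2) / (1 + ε * z.im) : ℝ) +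
          (z.im / (1 + ε * z.im) : ℝ) * Complex.I := by
        funext z
        exact Complex.mk_eq_add_mul_I _ _
      have h1 : ContinuousOn (fun z : ℂ => (z.re + ε * z.im / 2) / (1 + ε * z.im)) c :=
        ContinuousOn.div (by fun_prop) (by fun_prop) fun z hz => (hpos z hz).ne'
      have h2 : ContinuousOn (fun z : ℂ => z.im / (1 + ε * z.im)) c :=
        ContinuousOn.div (by fun_prop) (by fun_prop) fun z hz => (hpos z hz).ne'
      rw [e]
      exact (Complex.continuous_ofReal.comp_continuousOn h1).add
        ((Complex.continuous_ofReal.comp_continuousOn h2).mul continuousOn_const)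
    · intro z hz w hw e
      rw [← perspective_neg_perspective (hpos z hz).ne', e,
        perspective_neg_perspective (hpos w hw).ne']
    · intro z hz n r hn h0 hw
      have hh : ∀ w ∈ c, height ⟨n.re, n.im - ε * n.re / 2 + ε * r⟩ r (perspective ε w) =
          (1 + ε * w.im)⁻¹ * height n r w := fun w hwc => by
        rw [height_perspective _ _ (hpos w hwc).ne']
        congr 2
        exact Complex.ext rfl (by simp only; ring)
      refine ⟨⟨n.re, n.im - ε * n.re / 2 + ε * r⟩, r, fun e => ?_, ?_, fun w hwc => ?_⟩
      · have hre : n.re = 0 := congrArg Complex.re e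
        have him' : n.im - ε * n.re / 2 + ε * r = 0 := congrArg Complex.im e
        rw [hre] at him'
        have hnim : n.im = -(ε * r) := by linarith
        have hr : r * (1 + ε * z.im) = 0 := by
          rw [height, hre, hnim] at h0
          linarith
        have hr0 := (mul_eq_zero.1 hr).resolve_right (hpos z hz).ne'
        exact hn (Complex.ext hre (by rw [hnim, hr0]; simp))
      · rw [hh z hz, h0, mul_zero]
      · rw [hh w hwc]
        exact mul_nonneg (inv_pos.2 (hpos w hwc)).le (hw w hwc)
  · rintro _ ⟨z, hz, rfl⟩
    have h1 := hstrip z hz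
    have h2 := him z hz
    refine ⟨div_nonneg (by linarith [h1.1]) (hpos z hz).le, ?_⟩
    rw [perspective, div_le_one (hpos z hz)]
    linarith [h1.2]
  · rintro _ ⟨z, hz, rfl⟩ e
    have h1 := hstrip z hz
    have h2 := him z hz
    have e' : z.re + ε * z.im / 2 = 0 := (div_eq_zero_iff.1 e).resolve_right (hpos z hz).ne'
    have hi : z.im = 0 := (mul_eq_zero.1 (by linarith [h1.1] : ε * z.im = 0)).resolve_left hε
    simp [perspective, hi, Complex.ext_iff]
    linarith [h1.1]
  · rintro _ ⟨z, hz, rfl⟩ e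
    have h1 := hstrip z hz
    have h2 := him z hz
    have e' : z.re + ε * z.im / 2 = 1 + ε * z.im := (div_eq_one_iff_eq (hpos z hz).ne').1 e
    have hi : z.im = 0 := (mul_eq_zero.1 (by linarith [h1.2] : ε * z.im = 0)).resolve_left hε
    simp [perspective, hi, Complex.ext_iff]
    linarith [h1.2]

end IsSupportedArc

end

section

/-! ### Projectable curves -/

variable {σ τ c : Set ℂ} {x y : ℂ}

theorem isACEquiv_affine {e : σ ≃ τ} (hσ : Bornology.IsBounded σ) (hτ : Bornology.IsBounded τ)
    {a b : ℂ} (ha : a ≠ 0) (h : ∀ z, (e z : ℂ) = a * z + b) : IsACEquiv e where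
  isACMap := isACMap_affine hσ ha h
  isACMap_symm := isACMap_affine hτ (inv_ne_zero ha) (b := -(a⁻¹ * b)) fun w => by
    have := h (e.symm w)
    rw [e.apply_symm_apply] at this
    rw [this]
    field_simp
    ring

theorem isACEquiv_perspective {e : σ ≃ τ} (hσ : Bornology.IsBounded σ)
    (hτ : Bornology.IsBounded τ) {ε : ℝ} (hε : ∀ z ∈ σ, 0 ≤ ε * z.im)
    (h : ∀ z, (e z : ℂ) = perspective ε z) : IsACEquiv e := by
  have hpos : ∀ z ∈ σ, 1 ≤ 1 + ε * z.im := fun z hz => by linarith [hε z hz]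
  refine ⟨isACMap_perspective hσ one_pos hpos h, ?_⟩
  obtain ⟨M, hM⟩ := hσ.exists_norm_le
  have hδ : 0 < (1 + |ε| * |M|)⁻¹ := by positivity
  have hsymm : ∀ w, (e.symm w : ℂ) = perspective (-ε) w := fun w => by
    have := h (e.symm w)
    rw [e.apply_symm_apply] at this
    rw [this, perspective_neg_perspective (one_pos.trans_le (hpos _ (e.symm w).2)).ne']
  refine isACMap_perspective hτ (ε := -ε) hδ (fun w hw => ?_) hsymm
  obtain ⟨z, hz⟩ := e.surjective ⟨w, hw⟩
  have hwz : w = perspective ε z := by rw [← h, hz]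
  have h1 := hpos z z.2
  rw [hwz, one_sub_mul_perspective_im (one_pos.trans_le h1).ne']
  refine inv_anti₀ (one_pos.trans_le h1) ?_
  have h2 : ε * (z : ℂ).im ≤ |ε| * |M| := by
    refine (le_abs_self _).trans ?_
    rw [abs_mul]
    exact mul_le_mul_of_nonneg_left
      ((Complex.abs_im_le_norm _).trans ((hM z z.2).trans (le_abs_self M))) (abs_nonneg ε)
  linarith

theorem chordProj_eq (x y z : ℂ) (hxy : x ≠ y) :
    chordProj x y z = x + (((z - x) / (y - x)).re : ℂ) * (y - x) := by
  have hd : y - x ≠ 0 := sub_ne_zero.2 hxy.symm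
  rw [chordProj, EuclideanGeometry.coe_orthogonalProjection_eq_iff_mem]
  constructor
  · have := AffineMap.lineMap_mem_affineSpan_pair (((z - x) / (y - x)).re) x y
    rw [AffineMap.lineMap_apply] at this
    convert this using 1
    simp [add_comm]
  · rw [direction_affineSpan, vectorSpan_pair_rev,
      Submodule.mem_orthogonal_singleton_iff_inner_right]
    set w := (z - x) / (y - x) with hw
    have hz : z = x + w * (y - x) := by rw [hw]; field_simp; ring
    rw [hz]
    simp only [vsub_eq_sub, add_sub_add_left_eq_sub, Complex.inner, Complex.mul_re,
      Complex.conj_re, Complex.conj_im, Complex.sub_re, Complex.sub_im, Complex.mul_im,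
      Complex.ofReal_re, Complex.ofReal_im]
    ring

/-- The affine coordinate in which the chord from `x` to `y` becomes `[0, 1]`, with real part the
coordinate of the projection onto the chord. -/
theorem sub_div_eq_affine (x y z : ℂ) : (z - x) / (y - x) = (y - x)⁻¹ * z + -((y - x)⁻¹ * x) := by
  ring

theorem re_eq_of_chordProj_eq (hxy : x ≠ y) {z : ℂ} {s : ℝ}
    (h : chordProj x y z = x + s * (y - x)) : ((z - x) / (y - x)).re = s := by
  rw [chordProj_eq x y z hxy] at h
  exact_mod_cast mul_right_cancel₀ (sub_ne_zero.2 hxy.symm) (add_left_cancel h)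

/-- The normalization of a projectable curve is an arc over the chord `[0, 1]`. -/
theorem IsProjectable.normalize (h : IsProjectable c x y) :
    x ≠ y ∧ IsSupportedArc c x y ∧ IsSupportedArc ((fun z => (z - x) / (y - x)) '' c) 0 1 ∧
      ∀ z ∈ (fun z => (z - x) / (y - x)) '' c, z.re ∈ Icc (0 : ℝ) 1 := by
  have hc := h.1.isSupportedArc
  have hd : y - x ≠ 0 := sub_ne_zero.2 hc.ne.symm
  refine ⟨hc.ne, hc, ?_, ?_⟩
  · have := hc.image_affine (inv_ne_zero hd) (-((y - x)⁻¹ * x))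
    simp only [← sub_div_eq_affine] at this
    rwa [sub_self, zero_div, div_self hd] at this
  · rintro _ ⟨z, hz, rfl⟩
    have hs : chordProj x y z ∈ segment ℝ x y := h.2 ▸ mem_image_of_mem _ hz
    rw [segment_eq_image'] at hs
    obtain ⟨t, ht, e⟩ := hs
    rw [re_eq_of_chordProj_eq hc.ne (s := t) (by rw [← e]; simp)]
    exact ht

theorem div_injective (hxy : x ≠ y) : Function.Injective fun z : ℂ => (z - x) / (y - x) :=
  fun _ _ e => sub_left_injective ((div_left_inj' (sub_ne_zero.2 hxy.symm)).1 e)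

/-- Normalize the curve, tilt the lines orthogonal to the chord by a perspective, and project the
resulting graph onto the chord. -/
theorem IsProjectable.exists_isACEquiv (h : IsProjectable c x y) :
    ∃ e : c ≃ unitSeg, IsACEquiv e := by
  obtain ⟨hxy, hc, hA, hstrip⟩ := h.normalize
  set A : ℂ → ℂ := fun z => (z - x) / (y - x)
  obtain ⟨ε, hε, him⟩ : ∃ ε : ℝ, ε ≠ 0 ∧ ∀ z ∈ A '' c, 0 ≤ ε * z.im := by
    rcases hA.forall_im_nonneg_or_forall_im_nonpos hstrip with him | him
    · exact ⟨1, one_ne_zero, fun z hz => by simpa using him z hz⟩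
    · exact ⟨-1, by norm_num, fun z hz => by simpa using him z hz⟩
  obtain ⟨hP, hs, h0, h1⟩ := hA.perspective_image hstrip hε him
  obtain ⟨H, hH, hHc, hG⟩ := hP.exists_eq_graphSet hs h0 h1
  have hinj : InjOn (perspective ε) (A '' c) := fun z hz w hw e => by
    have hz' : 1 + ε * z.im ≠ 0 := by linarith [him z hz]
    have hw' : 1 + ε * w.im ≠ 0 := by linarith [him w hw]
    rw [← perspective_neg_perspective hz', e, perspective_neg_perspective hw']
  have e1 := isACEquiv_affine (e := Equiv.Set.image A c (div_injective hxy)) hc.isCompact.isBounded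
    hA.isCompact.isBounded (inv_ne_zero (sub_ne_zero.2 hxy.symm))
    fun z => sub_div_eq_affine x y z
  have e2 := isACEquiv_perspective
    (e := (Equiv.Set.imageOfInjOn (perspective ε) (A '' c) hinj).trans (Equiv.setCongr hG))
    hA.isCompact.isBounded (isBounded_graphSet hHc) him fun z => rfl
  exact ⟨_, (e1.trans e2).trans (isACEquiv_graphEquiv hH hHc)⟩

theorem IsProjectable.exists_isACEquiv_chordProj (h : IsProjectable c x y)
    (hseg : NoOrthogonalSegment c x y) :
    ∃ e : c ≃ unitSeg, IsACEquiv e ∧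
      ∀ (z : c) (s : unitSeg), chordProj x y z = x + s * (y - x) → e z = s := by
  obtain ⟨hxy, hc, hA, hstrip⟩ := h.normalize
  have hd : y - x ≠ 0 := sub_ne_zero.2 hxy.symm
  set A : ℂ → ℂ := fun z => (z - x) / (y - x) with hAdef
  obtain ⟨h0, h1⟩ := hA.eq_ends_of_no_vertical_segment hstrip fun z w hzw hsub e => by
    refine hseg (x + z * (y - x)) (x + w * (y - x)) (fun e' => hzw ?_) (fun p hp => ?_) ?_
    · exact mul_right_cancel₀ hd (add_left_cancel e')
    · rw [segment_eq_image'] at hp hsub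
      obtain ⟨l, hl, rfl⟩ := hp
      obtain ⟨q, hq, e'⟩ := hsub ⟨l, hl, rfl⟩
      have : q = x + z * (y - x) + l • (x + w * (y - x) - (x + z * (y - x))) := by
        have e'' : q - x = (z + l * (w - z)) * (y - x) := (div_eq_iff hd).1 (by
          simpa [hAdef] using e')
        rw [Complex.real_smul]
        linear_combination e''
      rwa [this] at hq
    · simp only [Complex.inner, Complex.mul_re, Complex.mul_im, Complex.conj_re, Complex.conj_im,
        Complex.sub_re, Complex.sub_im, Complex.add_re, Complex.add_im]
      rw [e]
      ring
  obtain ⟨H, hH, hHc, hG⟩ := hA.exists_eq_graphSet hstrip h0 h1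
  have e1 := isACEquiv_affine
    (e := (Equiv.Set.image A c (div_injective hxy)).trans (Equiv.setCongr hG))
    hc.isCompact.isBounded (isBounded_graphSet hHc) (inv_ne_zero hd) fun z => sub_div_eq_affine x y z
  refine ⟨_, e1.trans (isACEquiv_graphEquiv hH hHc), fun z s hs => ?_⟩
  obtain ⟨_, t, ht, rfl⟩ := s
  exact Subtype.ext (congrArg Complex.ofReal (re_eq_of_chordProj_eq hxy hs))

end

end PlaneAC

end

theorem mainTheorem6 :
    (∀ (c : Set ℂ) (x y : ℂ), PlaneAC.IsProjectable c x y →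
      Nonempty (PlaneAC.AC c ≃A[ℂ] PlaneAC.AC PlaneAC.unitSeg)) ∧
    (∀ (c : Set ℂ) (x y : ℂ), PlaneAC.IsProjectable c x y → PlaneAC.NoOrthogonalSegment c x y →
      ∃ Φ : PlaneAC.AC PlaneAC.unitSeg ≃A[ℂ] PlaneAC.AC c,
        ∀ (g : PlaneAC.AC PlaneAC.unitSeg) (z : c) (s : PlaneAC.unitSeg),
          PlaneAC.chordProj x y z = x + s * (y - x) → PlaneAC.acFun (Φ g) z = PlaneAC.acFun g s) ∧
    (∀ k : ℝ → ℝ, ConvexOn ℝ (Set.Icc 0 1) k → ContinuousOn k (Set.Icc 0 1) →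
      DifferentiableOn ℝ k (Set.Ioo 0 1) →
      (∀ g : PlaneAC.unitSeg → ℂ, PlaneAC.IsAC g ↔ PlaneAC.IsAC (PlaneAC.graphLift k g)) ∧
      ∃ Φ : PlaneAC.AC PlaneAC.unitSeg ≃A[ℂ] PlaneAC.AC (PlaneAC.graphSet k),
        ∀ g : PlaneAC.AC PlaneAC.unitSeg, PlaneAC.acFun (Φ g) = PlaneAC.graphLift k (PlaneAC.acFun g)) := by
  refine ⟨fun c x y h => ?_, fun c x y h hseg => ?_, fun k hk hc _ => ?_⟩
  · obtain ⟨e, he⟩ := h.exists_isACEquiv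
    exact ⟨he.symm.acEquiv⟩
  · obtain ⟨e, he, hes⟩ := h.exists_isACEquiv_chordProj hseg
    refine ⟨he.acEquiv, fun g z s hs => ?_⟩
    rw [he.acFun_acEquiv, Function.comp_apply, hes z s hs]
  · have he := PlaneAC.isACEquiv_graphEquiv (Or.inl hk) hc
    exact ⟨fun g => he.isAC_comp_iff.symm, he.acEquiv, fun g => he.acFun_acEquiv g⟩
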